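/- A graph is a finite CW complex $\Gamma$ of dimension at most $1$ (not necessarily connected). The degree of a vertex $v$ is the number of connected components of its complement in a sufficiently small connected neighborhood; $v$ is essential if its degree is at least $3$. Let $W$ be the set of all essential vertices of $\Gamma$ and $m=|W|$. For $k\ge 0$ let $F_k(X)=\{(x_1,\dots,x_k)\in X^k: x_i\ne x_j \text{ if } i\neq j\}$ and $B_k(X)=F_k(X)/\Sigma_k$ be the ordered and unordered configuration spaces, and let $S_n$ be the star graph with $n$ legs (the cone on $n$ points; $S_0$ is a point). Homology has integer coefficients. Let $S^1\to F_2(S_3)$ be the canonical loop in which two particles take turns passing through the center: writing $(a,b)$ for the configuration with the two particles at the ends of legs $a\neq b$, it runs piecewise linearly through $(0,1),(0,2),(1,2),(1,0),(2,0),(2,1),(0,1)$, the resting particle staying at the end of its leg while the other one moves through the center. It is equivariant for the antipodal map and the exchange of the particles, so it induces a loop $S^1\cong S^1/\{\pm1\}\to B_2(S_3)$. A maximal torus in $B_k(\Gamma)$ (where $k\ge 2m$) is the image in $H_m(B_k(\Gamma))$ of a fundamental class of $(S^1)^W$, i.e. a generator of $H_m((S^1)^W)\cong\mathbb Z$, under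 the homomorphism induced by a composite $$(S^1)^W\to B_2(S_3)^W\cong B_2(S_3)^W\times B_1(S_0)^{k-2m}\subseteq B_k\bigl(S_3^{\sqcup W}\sqcup S_0^{\sqcup (k-2m)}\bigr)\xrightarrow{B_k(\varphi)}B_k(\Gamma),$$ where $\varphi: S_3^{\sqcup W}\sqcup S_0^{\sqcup (k-2m)}\to\Gamma$ is a topological embedding and the first map is the product of the loops above. A maximal torus in $F_k(\Gamma)$ is defined in the same way with $F$ in place of $B$, after choosing a bijection between the set of the $k$ labels and the set of particles (two for each element of $W$ and $k-2m$ stationary ones). Then, for every graph $\Gamma$ and every $k$, every maximal torus in $B_k(\Gamma)$ is an element of infinite order of $H_m(B_k(\Gamma))$, and every maximal torus in $F_k(\Gamma)$ is an element of infinite order of $H_m(F_k(\Gamma))$. -/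

import Mathlib

noncomputable section

namespace GraphConf

open Set Filter Topology CategoryTheory

universe u v w

/-! ## Ordered and unordered configuration spaces -/

section Configurations

/-- Configurations of distinct points of `X`, labelled by `I` (topologized as a subspace of
`X ^ I`). For `I = Fin k` this is the ordered configuration space `F_k(X)`. -/
abbrev Conf (I : Type v) (X : Type u) : Type (max u v) := {c : I → X // Function.Injective c}

/-- Two labelled configurations are identified if they differ by a permutation of the labels. -/
def confSetoid (I : Type v) (X : Type u) : Setoid (Conf I X) where
  r c d := ∃ σ : Equiv.Perm I, d.1 = c.1 ∘ σ
  iseqv :=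
    { refl := fun c => ⟨1, rfl⟩
      symm := by
        rintro c d ⟨σ, h⟩
        exact ⟨σ.symm, by rw [h]; funext i; simp⟩
      trans := by
        rintro c d e ⟨σ, h⟩ ⟨τ, h'⟩
        exact ⟨τ.trans σ, by rw [h', h]; rfl⟩ }

/-- Unordered configurations: the quotient of `Conf I X` by the permutations of `I`, with the
quotient topology. For `I = Fin k` this is the unordered configuration space
`B_k(X) = F_k(X) / Σ_k`. -/
def UConf (I : Type v) (X : Type u) : Type (max u v) := Quotient (confSetoid I X)

instance (I : Type v) (X : Type u) [TopologicalSpace X] : TopologicalSpace (UConf I X) :=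
  inferInstanceAs (TopologicalSpace (Quotient (confSetoid I X)))

/-- The class of a labelled configuration in the unordered configuration space. -/
def UConf.mk {I : Type v} {X : Type u} (c : Conf I X) : UConf I X := Quotient.mk (confSetoid I X) c

theorem UConf.mk_eq {I : Type v} {X : Type u} {c d : Conf I X} (σ : Equiv.Perm I)
    (h : d.1 = c.1 ∘ σ) : UConf.mk c = UConf.mk d :=
  Quotient.sound (s := confSetoid I X) ⟨σ, h⟩

theorem UConf.mk_exact {I : Type v} {X : Type u} {c d : Conf I X}
    (h : UConf.mk c = UConf.mk d) : ∃ σ : Equiv.Perm I, d.1 = c.1 ∘ σ :=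
  Quotient.exact (s := confSetoid I X) h

theorem UConf.continuous_mk {I : Type v} {X : Type u} [TopologicalSpace X] :
    Continuous (UConf.mk : Conf I X → UConf I X) :=
  continuous_quotient_mk'

theorem UConf.isOpenQuotientMap_mk {I : Type v} {X : Type u} [TopologicalSpace X] :
    IsOpenQuotientMap (UConf.mk : Conf I X → UConf I X) := by
  refine ⟨Quotient.mk_surjective, UConf.continuous_mk, fun U hU => ?_⟩
  have key : (UConf.mk : Conf I X → UConf I X) ⁻¹' (UConf.mk '' U) =
      ⋃ σ : Equiv.Perm I,
        (fun c : Conf I X => (⟨c.1 ∘ σ, c.2.comp σ.injective⟩ : Conf I X)) ⁻¹' U := by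
    ext c
    simp only [mem_preimage, mem_image, mem_iUnion]
    constructor
    · rintro ⟨d, hd, h⟩
      obtain ⟨σ, hσ⟩ := UConf.mk_exact h.symm
      exact ⟨σ, by convert hd; exact hσ.symm⟩
    · rintro ⟨σ, hσ⟩
      exact ⟨_, hσ, (UConf.mk_eq σ rfl).symm⟩
  have : IsOpen ((UConf.mk : Conf I X → UConf I X) ⁻¹' (UConf.mk '' U)) := by
    rw [key]
    refine isOpen_iUnion fun σ => hU.preimage ?_
    exact Continuous.subtype_mk ((Pi.continuous_precomp σ).comp continuous_subtype_val) _
  exact this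

/-- The map of ordered configuration spaces induced by an injective continuous map. -/
def Conf.map (I : Type v) {X : Type u} {Y : Type w} [TopologicalSpace X] [TopologicalSpace Y]
    (φ : C(X, Y)) (hφ : Function.Injective φ) : C(Conf I X, Conf I Y) where
  toFun c := ⟨φ ∘ c.1, hφ.comp c.2⟩
  continuous_toFun := Continuous.subtype_mk (continuous_pi fun i =>
    φ.continuous.comp ((continuous_apply i).comp continuous_subtype_val)) _

/-- The map of unordered configuration spaces induced by an injective continuous map. -/
def UConf.map (I : Type v) {X : Type u} {Y : Type w} [TopologicalSpace X] [TopologicalSpace Y]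
    (φ : C(X, Y)) (hφ : Function.Injective φ) : C(UConf I X, UConf I Y) where
  toFun := Quotient.lift (fun c : Conf I X => UConf.mk (Conf.map I φ hφ c)) (by
    rintro c d ⟨σ, h⟩
    exact UConf.mk_eq σ (by simp only [Conf.map, ContinuousMap.coe_mk, h]; rfl))
  continuous_toFun := by
    refine Continuous.quotient_lift ?_ _
    exact UConf.continuous_mk.comp (Conf.map I φ hφ).continuous

/-- Renaming the labels along a bijection, for ordered configurations. -/
def Conf.reindex {I : Type v} {J : Type w} (X : Type u) [TopologicalSpace X] (e : I ≃ J) :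
    C(Conf I X, Conf J X) where
  toFun c := ⟨c.1 ∘ e.symm, c.2.comp e.symm.injective⟩
  continuous_toFun :=
    Continuous.subtype_mk ((Pi.continuous_precomp e.symm).comp continuous_subtype_val) _

/-- The identification of unordered configuration spaces with label sets of the same size (it does
not depend on the bijection). -/
def UConf.reindex {I : Type v} {J : Type w} (X : Type u) [TopologicalSpace X] (e : I ≃ J) :
    C(UConf I X, UConf J X) where
  toFun := Quotient.lift (fun c : Conf I X => UConf.mk (Conf.reindex X e c)) (by
    rintro c d ⟨σ, h⟩
    refine UConf.mk_eq ((e.symm.trans σ).trans e) ?_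
    funext j
    simp [Conf.reindex, h])
  continuous_toFun := by
    refine Continuous.quotient_lift ?_ _
    exact UConf.continuous_mk.comp (Conf.reindex X e).continuous

variable {A : Type u} {J : A → Type v} {X : A → Type w} [∀ a, TopologicalSpace (X a)]

/-- The inclusion `∏ₐ F_{J a}(X a) ⊆ F_{⊔ₐ J a}(⊔ₐ X a)`. -/
def Conf.sigma : C(∀ a, Conf (J a) (X a), Conf (Σ a, J a) (Σ a, X a)) where
  toFun c := ⟨fun p => ⟨p.1, (c p.1).1 p.2⟩, by
    rintro ⟨a, i⟩ ⟨b, j⟩ h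
    obtain ⟨h₁, h₂⟩ := Sigma.mk.inj_iff.1 h
    change a = b at h₁
    subst h₁
    exact congrArg (Sigma.mk a) ((c a).2 (eq_of_heq h₂))⟩
  continuous_toFun := by
    refine Continuous.subtype_mk (continuous_pi fun p => ?_) _
    exact continuous_sigmaMk.comp
      ((continuous_apply p.2).comp (continuous_subtype_val.comp (continuous_apply p.1)))

theorem Conf.mk_sigma_congr {c d : ∀ a, Conf (J a) (X a)}
    (h : ∀ a, UConf.mk (c a) = UConf.mk (d a)) :
    UConf.mk (Conf.sigma c) = UConf.mk (Conf.sigma d) := by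
  choose σ hσ using fun a => UConf.mk_exact (h a)
  refine UConf.mk_eq (Equiv.sigmaCongrRight σ) ?_
  funext ⟨a, i⟩
  exact congrArg (Sigma.mk a) (congrFun (hσ a) i)

/-- The inclusion `∏ₐ B_{J a}(X a) ⊆ B_{⊔ₐ J a}(⊔ₐ X a)`. -/
def UConf.sigma : C(∀ a, UConf (J a) (X a), UConf (Σ a, J a) (Σ a, X a)) where
  toFun c := UConf.mk (Conf.sigma fun a => Quotient.out (c a))
  continuous_toFun := by
    have hq : IsOpenQuotientMap (Pi.map fun a => (UConf.mk : Conf (J a) (X a) → _)) :=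
      IsOpenQuotientMap.piMap fun a => UConf.isOpenQuotientMap_mk
    rw [hq.isQuotientMap.continuous_iff]
    have : (fun c : ∀ a, UConf (J a) (X a) => UConf.mk (Conf.sigma fun a => Quotient.out (c a))) ∘
        (Pi.map fun a => (UConf.mk : Conf (J a) (X a) → _)) = UConf.mk ∘ Conf.sigma := by
      funext c
      exact Conf.mk_sigma_congr fun a => Quotient.out_eq _
    rw [this]
    exact UConf.continuous_mk.comp Conf.sigma.continuous

/-- `UConf.sigma` sends a tuple of classes to the class of the disjoint union. -/
theorem UConf.sigma_mk (c : ∀ a, Conf (J a) (X a)) :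
    UConf.sigma (fun a => UConf.mk (c a)) = UConf.mk (Conf.sigma c) :=
  Conf.mk_sigma_congr fun _ => Quotient.out_eq _

end Configurations

/-! ## Star graphs and the orbiting pair of particles -/

/-- The star graph with `n` legs, the cone on `n` points, realized as the union of the coordinate
segments `[0, eᵢ]` in `ℝⁿ`. For `n = 0` it is a point. -/
abbrev Star (n : ℕ) : Type :=
  {p : Fin n → ℝ // (∀ i, 0 ≤ p i ∧ p i ≤ 1) ∧ ∀ i j, i ≠ j → p i = 0 ∨ p j = 0}

/-- The unique point of the star with no legs. -/
def Star.point : Star 0 := ⟨fun i => i.elim0, fun i => i.elim0, fun i => i.elim0⟩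

/-- The height on leg `i` of the first particle at time `x`: it rests at the end of leg `i` while
`‖x - i/3‖ ≤ 1/12`, and leaves the leg linearly through the center on both sides. -/
def height (i : Fin 3) (x : UnitAddCircle) : ℝ :=
  max 0 (min 1 (2 - 12 * ‖x - (((i : ℕ) / 3 : ℝ) : UnitAddCircle)‖))

theorem continuous_height (i : Fin 3) : Continuous (height i) := by
  unfold height
  fun_prop

theorem norm_third {i j : Fin 3} (h : i ≠ j) :
    1 / 3 ≤ ‖((((i : ℕ) / 3 : ℝ) : UnitAddCircle) - (((j : ℕ) / 3 : ℝ) : UnitAddCircle))‖ := by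
  rw [← AddCircle.coe_sub, UnitAddCircle.norm_eq]
  generalize round (((i : ℕ) / 3 : ℝ) - (j : ℕ) / 3) = n
  have h1 : ((i : ℕ) / 3 : ℝ) - (j : ℕ) / 3 - n =
      ((((i : ℕ) : ℤ) - ((j : ℕ) : ℤ) - 3 * n : ℤ) : ℝ) / 3 := by
    push_cast; ring
  have h2 : (1 : ℤ) ≤ |((i : ℕ) : ℤ) - ((j : ℕ) : ℤ) - 3 * n| := by
    apply Int.one_le_abs
    have := i.2; have := j.2
    have : (i : ℕ) ≠ j := fun h' => h (Fin.ext h')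
    omega
  rw [h1, abs_div, abs_of_pos (show (0 : ℝ) < 3 by norm_num)]
  have h3 : (1 : ℝ) ≤ |((((i : ℕ) : ℤ) - ((j : ℕ) : ℤ) - 3 * n : ℤ) : ℝ)| := by
    exact_mod_cast h2
  linarith

theorem norm_lt_of_height_ne {i : Fin 3} {x : UnitAddCircle} (h : height i x ≠ 0) :
    ‖x - (((i : ℕ) / 3 : ℝ) : UnitAddCircle)‖ < 1 / 6 := by
  by_contra hc
  apply h
  unfold height
  rw [max_eq_left]
  refine (min_le_right _ _).trans ?_
  linarith

/-- The position of the first particle at time `x`: it visits the ends of the legs `0, 1, 2` at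
times `0, 1/3, 2/3`, passing through the center halfway in between. -/
def firstParticle (x : UnitAddCircle) : Star 3 :=
  ⟨fun i => height i x,
    fun i => ⟨le_max_left _ _, max_le zero_le_one (min_le_left _ _)⟩, by
    intro i j hij
    by_contra! hc
    have h1 := norm_lt_of_height_ne hc.1
    have h2 := norm_lt_of_height_ne hc.2
    have h3 := norm_third hij
    have h4 : ((((i : ℕ) / 3 : ℝ) : UnitAddCircle) - (((j : ℕ) / 3 : ℝ) : UnitAddCircle)) =
        (x - (((j : ℕ) / 3 : ℝ) : UnitAddCircle)) - (x - (((i : ℕ) / 3 : ℝ) : UnitAddCircle)) := by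
      abel
    rw [h4] at h3
    have h5 := norm_sub_le (x - (((j : ℕ) / 3 : ℝ) : UnitAddCircle))
      (x - (((i : ℕ) / 3 : ℝ) : UnitAddCircle))
    linarith⟩

theorem continuous_firstParticle : Continuous firstParticle :=
  Continuous.subtype_mk (continuous_pi fun i => continuous_height i) _

/-- Half a turn. -/
def half : UnitAddCircle := ((1 / 2 : ℝ) : UnitAddCircle)

theorem half_add_half : half + half = 0 := by
  rw [half, ← AddCircle.coe_add]
  norm_num

theorem norm_half : ‖half‖ = 1 / 2 := by
  have := AddCircle.norm_half_period_eq (1 : ℝ)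
  rw [half, this]; norm_num

theorem half_eq_neg : -half = half := neg_eq_of_add_eq_zero_left half_add_half

/-- At each time one of the two particles rests at the end of a leg. -/
theorem exists_rest (x : UnitAddCircle) :
    ∃ i : Fin 3, ‖x - (((i : ℕ) / 3 : ℝ) : UnitAddCircle)‖ ≤ 1 / 12 ∨
      ‖x + half - (((i : ℕ) / 3 : ℝ) : UnitAddCircle)‖ ≤ 1 / 12 := by
  obtain ⟨t, rfl⟩ := QuotientAddGroup.mk_surjective x
  change ∃ i : Fin 3, ‖((t : ℝ) : UnitAddCircle) - _‖ ≤ 1 / 12 ∨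
      ‖((t : ℝ) : UnitAddCircle) + half - _‖ ≤ 1 / 12
  have bound : ∀ (s : ℝ) (n : ℤ), |s - n| ≤ 1 / 12 → ‖((s : ℝ) : UnitAddCircle)‖ ≤ 1 / 12 := by
    intro s n h
    rw [UnitAddCircle.norm_eq]
    exact (round_le s n).trans h
  -- the multiple of `1/6` nearest to `t`
  obtain ⟨N, hN⟩ : ∃ N : ℤ, |6 * t - N| ≤ 1 / 2 := ⟨round (6 * t), abs_sub_round _⟩
  rw [abs_le] at hN
  have cases6 : N % 6 = 0 ∨ N % 6 = 1 ∨ N % 6 = 2 ∨ N % 6 = 3 ∨ N % 6 = 4 ∨ N % 6 = 5 := by omega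
  have hdiv : (N : ℝ) = 6 * ((N / 6 : ℤ) : ℝ) + ((N % 6 : ℤ) : ℝ) := by
    exact_mod_cast (Int.mul_ediv_add_emod N 6).symm
  rcases cases6 with h | h | h | h | h | h <;> rw [h] at hdiv
  · refine ⟨0, Or.inl ?_⟩
    rw [← AddCircle.coe_sub]
    refine bound _ (N / 6) (abs_le.2 ?_)
    norm_num at hdiv ⊢
    constructor <;> linarith
  · refine ⟨2, Or.inr ?_⟩
    rw [half, ← AddCircle.coe_add, ← AddCircle.coe_sub]
    refine bound _ (N / 6) (abs_le.2 ?_)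
    norm_num at hdiv ⊢
    constructor <;> linarith
  · refine ⟨1, Or.inl ?_⟩
    rw [← AddCircle.coe_sub]
    refine bound _ (N / 6) (abs_le.2 ?_)
    norm_num at hdiv ⊢
    constructor <;> linarith
  · refine ⟨0, Or.inr ?_⟩
    rw [half, ← AddCircle.coe_add, ← AddCircle.coe_sub]
    refine bound _ (N / 6 + 1) (abs_le.2 ?_)
    norm_num at hdiv ⊢
    constructor <;> linarith
  · refine ⟨2, Or.inl ?_⟩
    rw [← AddCircle.coe_sub]
    refine bound _ (N / 6) (abs_le.2 ?_)
    norm_num at hdiv ⊢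
    constructor <;> linarith
  · refine ⟨1, Or.inr ?_⟩
    rw [half, ← AddCircle.coe_add, ← AddCircle.coe_sub]
    refine bound _ (N / 6 + 1) (abs_le.2 ?_)
    norm_num at hdiv ⊢
    constructor <;> linarith

theorem firstParticle_ne (x : UnitAddCircle) : firstParticle x ≠ firstParticle (x + half) := by
  intro h
  have aux : ∀ (y z : UnitAddCircle) (i : Fin 3), height i y = height i z → ‖y - z‖ = 1 / 2 →
      ¬ ‖y - (((i : ℕ) / 3 : ℝ) : UnitAddCircle)‖ ≤ 1 / 12 := by
    intro y z i hyz hn hy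
    have h1 : height i y ≠ 0 := by
      unfold height
      rw [min_eq_left (by linarith)]
      norm_num
    have h2 := norm_lt_of_height_ne (hyz ▸ h1)
    have h3 := norm_sub_le (y - (((i : ℕ) / 3 : ℝ) : UnitAddCircle))
      (z - (((i : ℕ) / 3 : ℝ) : UnitAddCircle))
    rw [sub_sub_sub_cancel_right, hn] at h3
    linarith
  have hh : ∀ i, height i x = height i (x + half) := fun i => congrFun (congrArg Subtype.val h) i
  obtain ⟨i, hi | hi⟩ := exists_rest x
  · exact aux _ _ i (hh i) (by rw [sub_add_cancel_left, norm_neg, norm_half]) hi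
  · exact aux _ _ i (hh i).symm (by rw [add_sub_cancel_left, norm_half]) hi

/-- The canonical loop `S¹ → F_2(S_3)`, with `S¹ = ℝ/ℤ`: two particles orbit one another by taking
turns passing through the center, one resting at the end of a leg while the other one moves
linearly from one of the two remaining ends to the other. Writing `(a, b)` for the configuration
with the particles at the ends of the legs `a` and `b`, the loop runs through
`(0,1), (0,2), (1,2), (1,0), (2,0), (2,1)` and back. -/
def orbit : C(UnitAddCircle, Conf (Fin 2) (Star 3)) where
  toFun x := ⟨![firstParticle x, firstParticle (x + half)], by
    intro a b hab
    fin_cases a <;> fin_cases b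
    · rfl
    · exact absurd hab (firstParticle_ne x)
    · exact absurd hab.symm (firstParticle_ne x)
    · rfl⟩
  continuous_toFun := by
    refine Continuous.subtype_mk (continuous_pi fun a => ?_) _
    fin_cases a
    · exact continuous_firstParticle
    · exact continuous_firstParticle.comp (continuous_id.add continuous_const)

/-- The loop `orbit` is equivariant for the antipodal map and the exchange of the particles. -/
theorem mk_orbit_add_half (x : UnitAddCircle) :
    UConf.mk (orbit (x + half)) = UConf.mk (orbit x) := by
  refine UConf.mk_eq (Equiv.swap 0 1) ?_
  funext a
  fin_cases a <;> simp [orbit, add_assoc, half_add_half]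

theorem periodic_halfOrbit :
    Function.Periodic (fun t : ℝ => UConf.mk (orbit ((t / 2 : ℝ) : UnitAddCircle))) 1 := by
  intro t
  have : (((t + 1) / 2 : ℝ) : UnitAddCircle) = ((t / 2 : ℝ) : UnitAddCircle) + half := by
    rw [half, ← AddCircle.coe_add]; congr 1; ring
  simp only [this, mk_orbit_add_half]

/-- The canonical loop `S¹ → B_2(S_3)`: the loop induced by `orbit` on the quotient of `S¹` by the
antipodal map, which is identified with `S¹` by doubling. -/
def uorbit : C(UnitAddCircle, UConf (Fin 2) (Star 3)) where
  toFun := periodic_halfOrbit.lift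
  continuous_toFun := by
    refine continuous_coinduced_dom.2 ?_
    refine UConf.continuous_mk.comp (orbit.continuous.comp ?_)
    exact (AddCircle.continuous_mk' 1).comp (continuous_id.div_const 2)

/-- The defining property of `uorbit`. -/
theorem uorbit_two_nsmul (x : UnitAddCircle) : uorbit (2 • x) = UConf.mk (orbit x) := by
  obtain ⟨t, rfl⟩ := QuotientAddGroup.mk_surjective x
  change periodic_halfOrbit.lift ((2 • t : ℝ) : UnitAddCircle) = _
  rw [Function.Periodic.lift_coe]
  congr 3
  simp

/-! ## Tori in configuration spaces

`A` indexes the orbiting pairs, and there are `r` stationary particles. -/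

section Tori

variable (A : Type u) (r : ℕ)

/-- Three legs for the star of an orbiting pair, none for that of a stationary particle. -/
def legs : A ⊕ Fin r → ℕ := Sum.elim (fun _ => 3) (fun _ => 0)

/-- Two particles for each orbiting pair, one for each stationary particle. -/
def particles : A ⊕ Fin r → ℕ := Sum.elim (fun _ => 2) (fun _ => 1)

/-- The disjoint union `S_3^{⊔ A} ⊔ S_0^{⊔ r}` of star graphs. -/
abbrev Stars : Type u := Σ a : A ⊕ Fin r, Star (legs A r a)

/-- The set of all particles: two for each element of `A`, and `r` further ones. -/
abbrev Particle : Type u := Σ a : A ⊕ Fin r, Fin (particles A r a)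

/-- The map `(S¹)^A → F_2(S_3)^A ≅ F_2(S_3)^A × F_1(S_0)^r`. -/
def orbits : C(A → UnitAddCircle,
    ∀ a : A ⊕ Fin r, Conf (Fin (particles A r a)) (Star (legs A r a))) where
  toFun θ
    | Sum.inl a => orbit (θ a)
    | Sum.inr _ => ⟨fun _ : Fin 1 => Star.point, fun _ _ _ => Subsingleton.elim (α := Fin 1) _ _⟩
  continuous_toFun := by
    refine continuous_pi fun a => ?_
    rcases a with a | s
    · exact orbit.continuous.comp (continuous_apply a)
    · exact continuous_const

/-- The map `(S¹)^A → B_2(S_3)^A ≅ B_2(S_3)^A × B_1(S_0)^r`. -/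
def uorbits : C(A → UnitAddCircle,
    ∀ a : A ⊕ Fin r, UConf (Fin (particles A r a)) (Star (legs A r a))) where
  toFun θ
    | Sum.inl a => uorbit (θ a)
    | Sum.inr _ => UConf.mk (X := Star 0)
        ⟨fun _ : Fin 1 => Star.point, fun _ _ _ => Subsingleton.elim (α := Fin 1) _ _⟩
  continuous_toFun := by
    refine continuous_pi fun a => ?_
    rcases a with a | s
    · exact uorbit.continuous.comp (continuous_apply a)
    · exact continuous_const

variable {A r} {Γ : Type v} [TopologicalSpace Γ] {k : ℕ}

/-- The torus `(S¹)^A → F_2(S_3)^A × F_1(S_0)^r ⊆ F_k(S_3^{⊔ A} ⊔ S_0^{⊔ r}) → F_k(Γ)` given by a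
topological embedding `φ`. The bijection `e` specifies which of the `k` particles orbit where (and
which stay where). -/
def torus (φ : Stars A r → Γ) (hφ : IsEmbedding φ) (e : Particle A r ≃ Fin k) :
    C(A → UnitAddCircle, Conf (Fin k) Γ) :=
  (Conf.map (Fin k) ⟨φ, hφ.continuous⟩ hφ.injective).comp
    ((Conf.reindex (Stars A r) e).comp (Conf.sigma.comp (orbits A r)))

/-- The torus `(S¹)^A → B_2(S_3)^A × B_1(S_0)^r ⊆ B_k(S_3^{⊔ A} ⊔ S_0^{⊔ r}) → B_k(Γ)` given by a
topological embedding `φ`. The bijection `e` says that the number of particles is `k`; the map does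
not depend on it otherwise. -/
def utorus (φ : Stars A r → Γ) (hφ : IsEmbedding φ) (e : Particle A r ≃ Fin k) :
    C(A → UnitAddCircle, UConf (Fin k) Γ) :=
  (UConf.map (Fin k) ⟨φ, hφ.continuous⟩ hφ.injective).comp
    ((UConf.reindex (Stars A r) e).comp (UConf.sigma.comp (uorbits A r)))

end Tori

/-! ## Singular homology -/

/-- Integral singular homology. -/
abbrev H (n : ℕ) (X : Type u) [TopologicalSpace X] : ModuleCat.{u} ℤ :=
  ((AlgebraicTopology.singularHomologyFunctor (ModuleCat.{u} ℤ) n).obj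
    (ModuleCat.of ℤ (ULift.{u} ℤ))).obj (TopCat.of X)

/-- The homomorphism induced by a continuous map. -/
def H.map (n : ℕ) {X Y : Type u} [TopologicalSpace X] [TopologicalSpace Y] (f : C(X, Y)) :
    H n X →ₗ[ℤ] H n Y :=
  (((AlgebraicTopology.singularHomologyFunctor (ModuleCat.{u} ℤ) n).obj
    (ModuleCat.of ℤ (ULift.{u} ℤ))).map (TopCat.ofHom f)).hom

/-- A fundamental class of the torus `(S¹)^A` (for some orientation), that is, a generator of its
infinite cyclic top homology group. -/
def IsFundamentalClass (A : Type u) (x : H (Nat.card A) (A → UnitAddCircle)) : Prop :=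
  Submodule.span ℤ {x} = ⊤

/-! ## Essential vertices and maximal tori -/

/-- The point `v` has degree `n`: its complement in every sufficiently small connected
neighborhood has exactly `n` connected components. -/
def HasDegree {Γ : Type u} [TopologicalSpace Γ] (v : Γ) (n : ℕ) : Prop :=
  ∀ᶠ U in (𝓝 v).smallSets, U ∈ 𝓝 v → IsConnected U →
    Nat.card (ConnectedComponents ↥(U \ {v})) = n

/-- The vertices (that is, `0`-cells) of degree at least three. -/
def essentialVertices (Γ : Type u) [TopologicalSpace Γ] [CWComplex (univ : Set Γ)] : Set Γ :=
  {v | (∃ i : RelCWComplex.cell (univ : Set Γ) 0, v ∈ RelCWComplex.closedCell 0 i) ∧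
    ∃ n, 3 ≤ n ∧ HasDegree v n}

/-- The number `m(Γ)` of essential vertices. -/
abbrev essentialCount (Γ : Type u) [TopologicalSpace Γ] [CWComplex (univ : Set Γ)] : ℕ :=
  Nat.card (essentialVertices Γ)

/-- The homology class `α` is a maximal torus in the unordered configuration space `B_k(Γ)`. -/
def IsMaximalTorus {Γ : Type u} [TopologicalSpace Γ] [CWComplex (univ : Set Γ)] {k : ℕ}
    (α : H (essentialCount Γ) (UConf (Fin k) Γ)) : Prop :=
  ∃ (r : ℕ) (φ : Stars (essentialVertices Γ) r → Γ) (hφ : IsEmbedding φ)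
    (e : Particle (essentialVertices Γ) r ≃ Fin k)
    (x : H (essentialCount Γ) (essentialVertices Γ → UnitAddCircle)),
    IsFundamentalClass (essentialVertices Γ) x ∧ α = H.map _ (utorus φ hφ e) x

/-- The homology class `α` is a maximal torus in the ordered configuration space `F_k(Γ)`. -/
def IsMaximalOrderedTorus {Γ : Type u} [TopologicalSpace Γ] [CWComplex (univ : Set Γ)] {k : ℕ}
    (α : H (essentialCount Γ) (Conf (Fin k) Γ)) : Prop :=
  ∃ (r : ℕ) (φ : Stars (essentialVertices Γ) r → Γ) (hφ : IsEmbedding φ)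
    (e : Particle (essentialVertices Γ) r ≃ Fin k)
    (x : H (essentialCount Γ) (essentialVertices Γ → UnitAddCircle)),
    IsFundamentalClass (essentialVertices Γ) x ∧ α = H.map _ (torus φ hφ e) x

end GraphConf

end

noncomputable section

namespace GraphConf

open Set Filter Topology CategoryTheory

/-! A real cocycle vanishes on torsion, so it suffices to find a real cocycle of degree `m` on
`B_k(Γ)` that is nonzero on the torus; pulling it back to `F_k(Γ)` settles the ordered case.

Counting the net passages through an essential vertex into one chosen leg gives a class of degree
one, but it vanishes on the canonical loop: each particle enters the leg as often as it leaves it.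
So the passages are weighted. In the loop, a particle enters leg `l` while the other one is on leg
`l + 1`, and leaves it while the other one is on leg `l + 2`. If points of `Γ` carry weights `t`,
locally constant off the essential vertices, and these two legs have different weights, then
weighting each passage by the exponential of the weight of the pair yields a nonzero total.

The weight of the pair at `v` has no global meaning, but its variation does: `weightForm v` records
the changes of weight that occur at `v`. It is closed, possibly with periods, so the exponential of
a local primitive `R v` lives in a flat line bundle, and `exp (R v) * crossForm v` is a closed form
with values in it. The forms `weightForm v` add up to the differential of the total weight. Hence
the product of the line bundles is trivial, and the cup product of the `m` twisted classes is an
ordinary real cocycle, `crossingCochain`. The factor `exp (weight - ∑ v, R v)` in `crossingNumber`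
is the trivialization. On the torus, `R v` and `A v` depend on the coordinate `v` only, so the value
on the fundamental cycle is, up to a positive factor, the product of the periods
(`IsAdapted.sum_crossingCochain_ne_zero`).

The weights come from merging edges at the vertices of degree at most two. Each resulting class has
at most two ends at essential vertices, so three ends of edges at one vertex never have the same
class (`exists_edge_weights`). An embedded star with three legs is centered at an essential vertex,
its legs leaving along distinct ends of edges (`LocalStar.exists_arms`). Since there are as many
stars as essential vertices, all of these are centers, so the legs avoid them and have constant
weights (`GraphParam.exists_isAdapted`). -/

/-! ## Germs of functions up to constants and their primitives -/

section LocalForms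

variable {X : Type*} [TopologicalSpace X] {Y : Type*} [TopologicalSpace Y]

/-- Near each point, `u` is the difference of values of a function. -/
def LocallyExact (u : X → X → ℝ) : Prop :=
  ∀ x, ∃ a : X → ℝ, ∀ᶠ y in 𝓝 x, ∀ᶠ z in 𝓝 y, u y z = a z - a y

/-- The differences of values of `A` at nearby points are given by `u`. -/
def IsPrimitive (u : X → X → ℝ) (A : X → ℝ) : Prop :=
  ∀ x, ∀ᶠ y in 𝓝 x, u x y = A y - A x

theorem LocallyExact.comp {u : X → X → ℝ} (hu : LocallyExact u) {f : Y → X} (hf : Continuous f) :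
    LocallyExact fun y z => u (f y) (f z) := by
  intro y
  obtain ⟨a, ha⟩ := hu (f y)
  exact ⟨a ∘ f, (hf.continuousAt.eventually ha).mono fun z hz => hf.continuousAt.eventually hz⟩

theorem IsPrimitive.comp {u : X → X → ℝ} {A : X → ℝ} (h : IsPrimitive u A) {f : Y → X}
    (hf : Continuous f) : IsPrimitive (fun y z => u (f y) (f z)) (A ∘ f) :=
  fun y => hf.continuousAt.eventually (h (f y))

/-- Having the same value is an equivalence relation that holds locally, so connectedness propagates
it. Functions here are typically discontinuous elsewhere, so only eventual equality is used. -/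
theorem eq_of_eventually_eq {s : Set X} (hs : IsPreconnected s) {f : X → ℝ}
    (hf : ∀ x ∈ s, ∀ᶠ y in 𝓝 x, f y = f x) {x y : X} (hx : x ∈ s) (hy : y ∈ s) : f x = f y :=
  hs.induction₂ (fun a b => f a = f b)
    (fun a ha => ((hf a ha).mono fun _ h => h.symm).filter_mono inf_le_left)
    (fun _ _ _ _ _ _ h h' => h.trans h') (fun _ _ _ _ h => h.symm) hx hy

/-- Two primitives differ by a locally constant function. This makes the cochain independent of the
chosen primitives. -/
theorem IsPrimitive.sub_eq_sub [PreconnectedSpace X] {u : X → X → ℝ} {A A' : X → ℝ}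
    (h : IsPrimitive u A) (h' : IsPrimitive u A') (x y : X) : A y - A x = A' y - A' x := by
  have := eq_of_eventually_eq (f := fun z => A z - A' z) isPreconnected_univ (fun z _ => by
    filter_upwards [h z, h' z] with w hw hw'
    linarith) (mem_univ x) (mem_univ y)
  linarith

/-! ### Existence of primitives on compact convex sets -/

section Convex

variable {E : Type*} [NormedAddCommGroup E] [NormedSpace ℝ E] {K : Set E}

/-- In a convex set these intersections are convex. They are the overlaps on which two local
primitives must differ by a constant. -/
theorem isPreconnected_ball_inter_ball (hK : Convex ℝ K) (x y : K) (r : ℝ) :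
    IsPreconnected (Metric.ball x r ∩ Metric.ball y r) := by
  rw [← IsInducing.subtypeVal.isPreconnected_image]
  have : Subtype.val '' (Metric.ball x r ∩ Metric.ball y r) =
      K ∩ (Metric.ball (x : E) r ∩ Metric.ball (y : E) r) := by
    ext z
    constructor
    · rintro ⟨z, ⟨h1, h2⟩, rfl⟩
      exact ⟨z.2, h1, h2⟩
    · rintro ⟨hz, h1, h2⟩
      exact ⟨⟨z, hz⟩, ⟨h1, h2⟩, rfl⟩
  rw [this]
  exact (hK.inter ((convex_ball _ _).inter (convex_ball _ _))).isPreconnected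

/-- A subdivision argument: local differences that are additive at a fixed scale come from a
function. -/
theorem exists_primitive_of_additive (hK : Convex ℝ K) (hb : Bornology.IsBounded K)
    {δ : ℝ} (hδ : 0 < δ) (w : K → K → ℝ)
    (hw : ∀ x y z, dist x y < δ → dist y z < δ → dist x z < δ → w x y + w y z = w x z) :
    ∃ A : K → ℝ, ∀ x y, dist x y < δ / 2 → w x y = A y - A x := by
  rcases isEmpty_or_nonempty K with hemp | ⟨⟨o⟩⟩
  · exact ⟨fun _ => 0, fun x => hemp.elim x⟩
  obtain ⟨R, hR⟩ := Metric.isBounded_iff.1 hb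
  have hR0 : 0 ≤ R := by simpa using hR o.2 o.2
  -- Dividing a segment from `o` into `N` equal parts gives steps shorter than `δ / 2`.
  obtain ⟨N, hN⟩ := exists_nat_gt (2 * R / δ)
  have hN0 : (0 : ℝ) < N := lt_of_le_of_lt (by positivity) hN
  have hRN : R / N < δ / 2 := by
    rw [div_lt_iff₀ hδ] at hN
    rw [div_lt_iff₀ hN0]
    linarith
  have hmem : ∀ (x : K) (j : ℕ), j ≤ N →
      AffineMap.lineMap (o : E) (x : E) ((j : ℝ) / N) ∈ K := fun x j hj =>
    hK.lineMap_mem o.2 x.2 ⟨by positivity, by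
      rw [div_le_one hN0]; exact_mod_cast hj⟩
  -- The `j`-th division point of the segment from `o` to `x`; the default value for `j > N` plays
  -- no role.
  let P : K → ℕ → K := fun x j => if hj : j ≤ N then ⟨_, hmem x j hj⟩ else o
  have hP : ∀ x j, j ≤ N → (P x j : E) = AffineMap.lineMap (o : E) (x : E) ((j : ℝ) / N) :=
    fun x j hj => by simp [P, hj]
  have hP0 : ∀ x, P x 0 = o := fun x => Subtype.ext (by rw [hP x 0 (Nat.zero_le _)]; simp)
  have hPN : ∀ x, P x N = x := fun x => Subtype.ext (by
    rw [hP x N le_rfl, div_self hN0.ne']; simp)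
  have step : ∀ x j, j < N → dist (P x j) (P x (j + 1)) < δ / 2 := by
    intro x j hj
    rw [Subtype.dist_eq, hP x j hj.le, hP x (j + 1) hj, dist_lineMap_lineMap]
    have h1 : dist ((j : ℝ) / N) (((j + 1 : ℕ) : ℝ) / N) = 1 / N := by
      rw [Real.dist_eq, ← sub_div, abs_div, abs_of_pos hN0]
      push_cast
      simp
    rw [h1]
    refine lt_of_le_of_lt ?_ hRN
    rw [div_mul_eq_mul_div, one_mul]
    gcongr
    exact hR o.2 x.2
  have cross : ∀ x y j, j ≤ N → dist x y < δ / 2 → dist (P x j) (P y j) < δ / 2 := by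
    intro x y j hj hxy
    rw [Subtype.dist_eq, hP x j hj, hP y j hj]
    refine lt_of_le_of_lt ?_ hxy
    have hj1 : (j : ℝ) / N ≤ 1 := by rw [div_le_one hN0]; exact_mod_cast hj
    have hj0 : (0 : ℝ) ≤ (j : ℝ) / N := by positivity
    calc dist (AffineMap.lineMap (o : E) (x : E) ((j : ℝ) / N) : E)
          (AffineMap.lineMap (o : E) (y : E) ((j : ℝ) / N))
        = (j : ℝ) / N * dist (x : E) y := by
          simp only [AffineMap.lineMap_apply_module, dist_eq_norm]
          rw [add_sub_add_left_eq_sub, ← smul_sub, norm_smul, Real.norm_of_nonneg hj0]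
      _ ≤ 1 * dist (x : E) y := by gcongr
      _ = dist x y := one_mul _
  have self : ∀ x, w x x = 0 := fun x => by
    have := hw x x x (by simpa) (by simpa) (by simpa)
    linarith
  refine ⟨fun x => ∑ j ∈ Finset.range N, w (P x j) (P x (j + 1)), fun x y hxy => ?_⟩
  -- The segments to `x` and `y` form a ladder. Each cell is cut by a diagonal into two triangles on
  -- which `w` is additive; the last rung joins `x` to `y`.
  have ladder : ∀ n, n ≤ N → w (P x n) (P y n) =
      ∑ j ∈ Finset.range n, w (P y j) (P y (j + 1)) -
        ∑ j ∈ Finset.range n, w (P x j) (P x (j + 1)) := by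
    intro n
    induction n with
    | zero => intro _; simp [hP0, self]
    | succ n ih =>
      intro hn
      have hn' : n < N := hn
      have h1 := step x n hn'
      have h2 := step y n hn'
      have h3 := cross x y n hn'.le hxy
      have h4 := cross x y (n + 1) hn hxy
      have h5 : dist (P x n) (P y (n + 1)) < δ :=
        (dist_triangle _ (P y n) _).trans_lt (by linarith)
      have e1 := hw (P x n) (P x (n + 1)) (P y (n + 1)) (by linarith) (by linarith) h5
      have e2 := hw (P x n) (P y n) (P y (n + 1)) (by linarith) (by linarith) h5
      rw [Finset.sum_range_succ, Finset.sum_range_succ]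
      have := ih hn'.le
      linarith
  simpa [hPN] using ladder N le_rfl

/-- On a compact convex set, locally exact differences have a primitive. -/
theorem LocallyExact.exists_primitive (hK : Convex ℝ K) (hc : IsCompact K) {u : K → K → ℝ}
    (hu : LocallyExact u) : ∃ A, IsPrimitive u A := by
  choose a ha using hu
  have hcs : IsCompact (univ : Set K) := isCompact_iff_isCompact_univ.1 hc
  obtain ⟨δ, hδ, hball⟩ := lebesgue_number_lemma_of_metric hcs
    (c := fun x => interior {y | ∀ᶠ z in 𝓝 y, u y z = a x z - a x y}) (fun _ => isOpen_interior)
    (fun x _ => mem_iUnion.2 ⟨x, mem_interior_iff_mem_nhds.2 (ha x)⟩)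
  choose p hp using fun x => hball x (mem_univ x)
  have hp' : ∀ x, ∀ y ∈ Metric.ball x δ, ∀ᶠ z in 𝓝 y, u y z = a (p x) z - a (p x) y :=
    fun x y hy => show y ∈ {y | ∀ᶠ z in 𝓝 y, u y z = a (p x) z - a (p x) y} from
      interior_subset (hp x hy)
  -- On the connected overlap of two balls both local primitives have the differences `u`.
  have const : ∀ x x' y z, dist y x < δ → dist y x' < δ → dist z x < δ → dist z x' < δ →
      a (p x) z - a (p x) y = a (p x') z - a (p x') y := by
    intro x x' y z h1 h2 h3 h4
    have := eq_of_eventually_eq (isPreconnected_ball_inter_ball hK x x' δ)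
      (f := fun z => a (p x) z - a (p x') z) (fun z hz => by
        filter_upwards [hp' x z hz.1, hp' x' z hz.2] with w h h'
        linarith) (x := y) (y := z) ⟨h1, h2⟩ ⟨h3, h4⟩
    linarith
  obtain ⟨A, hA⟩ := exists_primitive_of_additive hK hc.isBounded hδ
    (fun x y => a (p x) y - a (p x) x) (fun x y z hxy hyz hxz => by
      have := const x y y z (by rwa [dist_comm]) (by simpa) (by rwa [dist_comm])
        (by rwa [dist_comm])
      linarith)
  refine ⟨A, fun x => ?_⟩
  filter_upwards [hp' x x (Metric.mem_ball_self hδ), Metric.ball_mem_nhds x (half_pos hδ)]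
    with y h1 h2
  rw [h1, hA x y (by rwa [dist_comm])]

end Convex

end LocalForms

/-! ## Developing functions of a family of configurations -/

/-- Distinct points `pt v` of a space, a weight `t` that is locally constant on the complement of
these points, and a function `χ v` near each of them that is locally constant except at `pt v`. -/
structure CutData (Γ : Type*) [TopologicalSpace Γ] (m : ℕ) where
  pt : Fin m → Γ
  pt_injective : Function.Injective pt
  t : Γ → ℝ
  eventually_t : ∀ x, (∀ v, x ≠ pt v) → ∀ᶠ y in 𝓝 x, t y = t x
  χ : Fin m → Γ → ℝ
  χ_pt : ∀ v, χ v (pt v) = 0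
  eventually_χ : ∀ v, ∀ᶠ y in 𝓝 (pt v), y ≠ pt v → ∀ᶠ z in 𝓝 y, χ v z = χ v y

namespace CutData

variable {Γ : Type*} [TopologicalSpace Γ] {m : ℕ} (D : CutData Γ m) {I : Type*} [Fintype I]

/-- The total weight of a configuration. -/
def weight (c : Conf I Γ) : ℝ := ∑ i, D.t (c.1 i)

open Classical in
/-- The change of the weight when a particle moves away from `pt v`. -/
def weightForm (v : Fin m) (c d : Conf I Γ) : ℝ :=
  ∑ i, if c.1 i = D.pt v then D.t (d.1 i) - D.t (D.pt v) else 0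

open Classical in
/-- The change of `χ v` when a particle moves away from `pt v`. -/
def crossForm (v : Fin m) (c d : Conf I Γ) : ℝ :=
  ∑ i, if c.1 i = D.pt v then D.χ v (d.1 i) else 0

theorem weightForm_perm (v : Fin m) {c d c' d' : Conf I Γ} (σ : Equiv.Perm I)
    (h : c'.1 = c.1 ∘ σ) (h' : d'.1 = d.1 ∘ σ) :
    D.weightForm v c' d' = D.weightForm v c d := by
  classical
  unfold weightForm
  rw [h, h']
  exact Equiv.sum_comp σ fun i => if c.1 i = D.pt v then D.t (d.1 i) - D.t (D.pt v) else 0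

theorem crossForm_perm (v : Fin m) {c d c' d' : Conf I Γ} (σ : Equiv.Perm I)
    (h : c'.1 = c.1 ∘ σ) (h' : d'.1 = d.1 ∘ σ) :
    D.crossForm v c' d' = D.crossForm v c d := by
  classical
  unfold crossForm
  rw [h, h']
  exact Equiv.sum_comp σ fun i => if c.1 i = D.pt v then D.χ v (d.1 i) else 0

theorem weight_perm {c c' : Conf I Γ} (σ : Equiv.Perm I) (h : c'.1 = c.1 ∘ σ) :
    D.weight c' = D.weight c := by
  unfold weight
  rw [h]
  exact Equiv.sum_comp σ fun i => D.t (c.1 i)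

omit [Fintype I] in
theorem continuous_particle (i : I) : Continuous fun c : Conf I Γ => c.1 i :=
  (continuous_apply i).comp continuous_subtype_val

theorem weightForm_eq_zero {v : Fin m} {c d : Conf I Γ}
    (h : ∀ i, c.1 i = D.pt v → d.1 i = D.pt v) : D.weightForm v c d = 0 := by
  refine Finset.sum_eq_zero fun i _ => ?_
  split_ifs with hi
  · rw [h i hi, sub_self]
  · rfl

/-- Near `c` only a particle that is at `pt v` in `c` matters, and its weight is a local primitive.
Once it has left `pt v` it is near no other cut point, so its weight is locally constant and both
sides vanish. How near `e` must be to `d` depends on `d`, since `t` may jump at `pt v`. -/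
theorem locallyExact_weightForm [T2Space Γ] (v : Fin m) :
    LocallyExact (D.weightForm v : Conf I Γ → Conf I Γ → ℝ) := by
  classical
  intro c
  refine ⟨fun d => ∑ i, if c.1 i = D.pt v then D.t (d.1 i) else 0, ?_⟩
  have h1 : ∀ᶠ d : Conf I Γ in 𝓝 c, ∀ i, c.1 i ≠ D.pt v → d.1 i ≠ D.pt v :=
    eventually_all.2 fun i => by
      by_cases hi : c.1 i = D.pt v
      · exact Eventually.of_forall fun d h => absurd hi h
      · exact ((continuous_particle i).continuousAt.eventually_ne hi).mono fun d h _ => h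
  have h2 : ∀ᶠ d : Conf I Γ in 𝓝 c, ∀ i, c.1 i = D.pt v → ∀ w, w ≠ v → d.1 i ≠ D.pt w :=
    eventually_all.2 fun i => by
      by_cases hi : c.1 i = D.pt v
      · refine (eventually_all.2 fun w => ?_).mono fun d h _ => h
        by_cases hw : w = v
        · exact Eventually.of_forall fun d h => absurd hw h
        · exact ((continuous_particle i).continuousAt.eventually_ne
            (hi.trans_ne (D.pt_injective.ne (Ne.symm hw)))).mono fun d h _ => h
      · exact Eventually.of_forall fun d h => absurd h hi
  filter_upwards [h1, h2] with d h1 h2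
  have h3 : ∀ᶠ e : Conf I Γ in 𝓝 d, ∀ i, (∀ w, d.1 i ≠ D.pt w) → D.t (e.1 i) = D.t (d.1 i) :=
    eventually_all.2 fun i => by
      by_cases hi : ∀ w, d.1 i ≠ D.pt w
      · exact ((continuous_particle i).continuousAt.eventually (D.eventually_t _ hi)).mono
          fun _ h _ => h
      · exact Eventually.of_forall fun _ h => absurd h hi
  filter_upwards [h3] with e h3
  rw [← Finset.sum_sub_distrib]
  refine Finset.sum_congr rfl fun i _ => ?_
  by_cases hc : c.1 i = D.pt v
  · by_cases hd : d.1 i = D.pt v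
    · simp [hc, hd]
    · have := h3 i fun w => by
        by_cases hw : w = v
        · rwa [hw]
        · exact h2 i hc w hw
      simp [hc, hd, this]
  · simp [hc, h1 i hc]

/-- The weight of a particle can only change at a cut point, and then at a single one. This relation
is what trivializes the product of the line bundles. -/
theorem weight_sub_weight {c : Conf I Γ} :
    ∀ᶠ d in 𝓝 c, D.weight d - D.weight c = ∑ v, D.weightForm v c d := by
  classical
  have h : ∀ᶠ d : Conf I Γ in 𝓝 c, ∀ i, (∀ w, c.1 i ≠ D.pt w) → D.t (d.1 i) = D.t (c.1 i) :=
    eventually_all.2 fun i => by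
      by_cases hi : ∀ w, c.1 i ≠ D.pt w
      · exact ((continuous_particle i).continuousAt.eventually (D.eventually_t _ hi)).mono
          fun _ h _ => h
      · exact Eventually.of_forall fun _ h => absurd h hi
  filter_upwards [h] with d h
  unfold weight weightForm
  rw [Finset.sum_comm, ← Finset.sum_sub_distrib]
  refine Finset.sum_congr rfl fun i _ => ?_
  by_cases hi : ∃ v, c.1 i = D.pt v
  · obtain ⟨v, hv⟩ := hi
    rw [Finset.sum_eq_single v, if_pos hv, hv]
    · intro w _ hw
      exact if_neg fun h => hw (D.pt_injective (h.symm.trans hv))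
    · simp
  · push Not at hi
    rw [h i hi, sub_self, Finset.sum_eq_zero]
    exact fun v _ => if_neg (hi v)

/-! ### Twisted crossing forms and their products -/

variable {Y : Type*} [TopologicalSpace Y] {Z : Type*} [TopologicalSpace Z]

/-- At most one particle is at `pt v`. As long as it stays there no weight changes at `v`, so `R`
keeps the value `R x` whenever a crossing can occur. Thus `exp (R x)` times `χ v` of this particle
is a local primitive. -/
theorem locallyExact_crossForm [T2Space Γ] (v : Fin m) {s : Y → Conf I Γ} (hs : Continuous s)
    {R : Y → ℝ} (hR : IsPrimitive (fun y z => D.weightForm v (s y) (s z)) R) :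
    LocallyExact fun y z => Real.exp (R y) * D.crossForm v (s y) (s z) := by
  classical
  intro x
  refine ⟨fun y => ∑ i, if (s x).1 i = D.pt v then Real.exp (R x) * D.χ v ((s y).1 i) else 0, ?_⟩
  have hcont : ∀ i, Continuous fun y => (s y).1 i := fun i => (continuous_particle i).comp hs
  have h1 : ∀ᶠ y in 𝓝 x, ∀ i, (s x).1 i ≠ D.pt v → (s y).1 i ≠ D.pt v :=
    eventually_all.2 fun i => by
      by_cases hi : (s x).1 i = D.pt v
      · exact Eventually.of_forall fun d h => absurd hi h
      · exact ((hcont i).continuousAt.eventually_ne hi).mono fun d h _ => h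
  have h2 : ∀ᶠ y in 𝓝 x, ∀ i, (s x).1 i = D.pt v → (s y).1 i ≠ D.pt v →
      ∀ᶠ z in 𝓝 ((s y).1 i), D.χ v z = D.χ v ((s y).1 i) :=
    eventually_all.2 fun i => by
      by_cases hi : (s x).1 i = D.pt v
      · have h := D.eventually_χ v
        rw [← hi] at h
        refine ((hcont i).continuousAt.eventually h).mono fun y hy _ h => hy ?_
        rwa [hi]
      · exact Eventually.of_forall fun d h => absurd h hi
  filter_upwards [h1, h2, hR x] with y h1 h2 hRy
  have h3 : ∀ᶠ z in 𝓝 y, ∀ i, (s x).1 i = D.pt v → (s y).1 i ≠ D.pt v →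
      D.χ v ((s z).1 i) = D.χ v ((s y).1 i) :=
    eventually_all.2 fun i => by
      by_cases hi : (s x).1 i = D.pt v ∧ (s y).1 i ≠ D.pt v
      · exact ((hcont i).continuousAt.eventually (h2 i hi.1 hi.2)).mono fun z h _ _ => h
      · exact Eventually.of_forall fun z h h' => absurd ⟨h, h'⟩ hi
  filter_upwards [h3] with z h3
  unfold crossForm
  rw [Finset.mul_sum, ← Finset.sum_sub_distrib]
  refine Finset.sum_congr rfl fun i _ => ?_
  by_cases hx : (s x).1 i = D.pt v
  · by_cases hy : (s y).1 i = D.pt v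
    -- The particle at `pt v` in `s x` is unique and is still there in `s y`.
    · have hRe : R y = R x := by
        rw [D.weightForm_eq_zero] at hRy
        · linarith
        · intro j hj
          rwa [(s x).2 (hj.trans hx.symm)]
      simp [hx, hy, hRe, D.χ_pt]
    · simp [hx, hy, h3 i hx hy]
  · simp [hx, h1 i hx]

/-- Functions `R v` and `A v` on the parameter space of a family `s` of configurations that record
the weight near `pt v` and the weighted number of crossings of `pt v`. -/
structure IsDeveloping (s : Y → Conf I Γ) (R A : Fin m → Y → ℝ) : Prop where
  weight : ∀ v, IsPrimitive (fun y z => D.weightForm v (s y) (s z)) (R v)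
  cross : ∀ v, IsPrimitive (fun y z => Real.exp (R v y) * D.crossForm v (s y) (s z)) (A v)

theorem exists_isDeveloping [T2Space Γ] {E : Type*} [NormedAddCommGroup E] [NormedSpace ℝ E]
    {K : Set E} (hK : Convex ℝ K) (hc : IsCompact K) {s : K → Conf I Γ} (hs : Continuous s) :
    ∃ R A, D.IsDeveloping s R A := by
  choose R hR using fun v => ((D.locallyExact_weightForm v).comp hs).exists_primitive hK hc
  choose A hA using fun v => (D.locallyExact_crossForm v hs (hR v)).exists_primitive hK hc
  exact ⟨R, A, hR, hA⟩

variable {D}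

theorem IsDeveloping.comp {s : Y → Conf I Γ} {R A : Fin m → Y → ℝ} (h : D.IsDeveloping s R A)
    {f : Z → Y} (hf : Continuous f) :
    D.IsDeveloping (s ∘ f) (fun v => R v ∘ f) (fun v => A v ∘ f) :=
  ⟨fun v => (h.weight v).comp hf, fun v => (h.cross v).comp hf⟩

theorem IsDeveloping.perm {s s' : Y → Conf I Γ} {R A : Fin m → Y → ℝ} (h : D.IsDeveloping s R A)
    (σ : Equiv.Perm I) (hs : ∀ y, (s' y).1 = (s y).1 ∘ σ) : D.IsDeveloping s' R A := by
  refine ⟨fun v => ?_, fun v => ?_⟩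
  · simpa only [D.weightForm_perm v σ (hs _) (hs _)] using h.weight v
  · simpa only [D.crossForm_perm v σ (hs _) (hs _)] using h.cross v

variable (D) in
/-- The product of the weighted crossing numbers of the steps of a sequence of parameters. -/
def crossingNumber (s : Y → Conf I Γ) (R A : Fin m → Y → ℝ) (p : Fin (m + 1) → Y) : ℝ :=
  Real.exp (D.weight (s (p 0)) - ∑ v, R v (p 0)) * ∏ v, (A v (p v.succ) - A v (p v.castSucc))

/-- The total weight and `∑ v, R v` have the same local differences, by `weight_sub_weight`. -/
theorem IsDeveloping.weight_sub_eq [PreconnectedSpace Y] {s : Y → Conf I Γ}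
    {R A : Fin m → Y → ℝ} (h : D.IsDeveloping s R A) (hs : Continuous s) (x y : Y) :
    D.weight (s x) - ∑ v, R v x = D.weight (s y) - ∑ v, R v y := by
  refine eq_of_eventually_eq (f := fun x => D.weight (s x) - ∑ v, R v x) isPreconnected_univ
    (fun x _ => ?_) (mem_univ x) (mem_univ y)
  filter_upwards [hs.continuousAt.eventually D.weight_sub_weight,
    eventually_all.2 fun v => h.weight v x] with y h1 h2
  simp only [h2, Finset.sum_sub_distrib] at h1
  linarith

/-- Adding a constant `c v` to `R v` multiplies the differences of `A v` by `exp (c v)` and the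
prefactor by `exp (-∑ v, c v)`. Constants added to `A v` drop out. -/
theorem IsDeveloping.crossingNumber_eq [PreconnectedSpace Y] {s : Y → Conf I Γ}
    {R A R' A' : Fin m → Y → ℝ} (h : D.IsDeveloping s R A) (h' : D.IsDeveloping s R' A')
    (p : Fin (m + 1) → Y) : D.crossingNumber s R A p = D.crossingNumber s R' A' p := by
  have hR : ∀ v y, R' v y = R v y + (R' v (p 0) - R v (p 0)) := fun v y => by
    linarith [(h.weight v).sub_eq_sub (h'.weight v) (p 0) y]
  have hA : ∀ v x y,
      A' v y - A' v x = Real.exp (R' v (p 0) - R v (p 0)) * (A v y - A v x) := by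
    intro v x y
    have : IsPrimitive (fun y z => Real.exp (R' v y) * D.crossForm v (s y) (s z))
        (fun y => Real.exp (R' v (p 0) - R v (p 0)) * A v y) := by
      intro y
      filter_upwards [h.cross v y] with z hz
      rw [hR v y, Real.exp_add, ← mul_sub, ← hz]
      ring
    rw [(h'.cross v).sub_eq_sub this, mul_sub]
  unfold crossingNumber
  simp only [hA, Finset.prod_mul_distrib, ← Real.exp_sum]
  rw [← mul_assoc, ← Real.exp_add, Finset.sum_sub_distrib]
  congr 2
  ring

omit [TopologicalSpace Y] in
theorem crossingNumber_perm {s s' : Y → Conf I Γ} {R A : Fin m → Y → ℝ}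
    (σ : Equiv.Perm I) (hs : ∀ y, (s' y).1 = (s y).1 ∘ σ) (p : Fin (m + 1) → Y) :
    D.crossingNumber s' R A p = D.crossingNumber s R A p := by
  unfold crossingNumber
  rw [D.weight_perm σ (hs _)]

end CutData

/-- The coboundary of a product of differences vanishes. -/
theorem sum_prod_sub_succAbove : ∀ (m : ℕ) (A : Fin m → Fin (m + 2) → ℝ),
    ∑ j : Fin (m + 2), (-1 : ℝ) ^ (j : ℕ) *
      ∏ v : Fin m, (A v (j.succAbove v.succ) - A v (j.succAbove v.castSucc)) = 0
  | 0, A => by simp [Fin.sum_univ_two]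
  | m + 1, A => by
    -- The faces `0` and `1` share all factors but the first, and their signed first factors add up
    -- to `-(A 0 1 - A 0 0)`. All other faces have first factor `A 0 1 - A 0 0`. What remains is the
    -- identity for the other functions on the vertices after the first.
    have ih := sum_prod_sub_succAbove m fun v p => A v.succ p.succ
    rw [Fin.sum_univ_succ] at ih ⊢
    rw [Fin.sum_univ_succ]
    simp only [Fin.prod_univ_succ, Fin.succ_succAbove_succ, Fin.succAbove_zero, Fin.succ_succAbove_zero,
      Fin.castSucc_zero, ← Fin.succ_castSucc, Fin.val_zero, Fin.val_succ, pow_succ, pow_zero] at ih ⊢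
    have h : ∀ (a : ℝ) (f g : Fin (m + 1) → ℝ), ∑ x, f x * -1 * -1 * (a * g x) =
        -a * ∑ x, f x * -1 * g x := fun a f g => by
      rw [Finset.mul_sum]
      exact Finset.sum_congr rfl fun x _ => by ring
    rw [h]
    linear_combination (-(A 0 (Fin.succ 0) - A 0 0)) * ih

/-- The exponential factor is the same at every vertex, so it does not matter that the face `0` has
another initial vertex. -/
theorem CutData.IsDeveloping.sum_crossingNumber_succAbove {Γ : Type*} [TopologicalSpace Γ]
    {m : ℕ} {D : CutData Γ m} {I : Type*} [Fintype I] {Y : Type*} [TopologicalSpace Y]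
    [PreconnectedSpace Y] {s : Y → Conf I Γ} {R A : Fin m → Y → ℝ} (h : D.IsDeveloping s R A)
    (hs : Continuous s) (p : Fin (m + 2) → Y) :
    ∑ j : Fin (m + 2), (-1 : ℝ) ^ (j : ℕ) * D.crossingNumber s R A (p ∘ j.succAbove) = 0 := by
  have := sum_prod_sub_succAbove m fun v q => A v (p q)
  rw [← mul_eq_zero_of_right (Real.exp (D.weight (s (p 0)) - ∑ v, R v (p 0))) this,
    Finset.mul_sum]
  refine Finset.sum_congr rfl fun j _ => ?_
  unfold CutData.crossingNumber
  rw [h.weight_sub_eq hs _ (p 0)]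
  simp only [Function.comp_apply]
  ring

/-! ## Singular cocycles and finite cycles -/

section Homology

universe u

/-- The standard topological simplex. -/
abbrev Simplex (n : ℕ) : Type := stdSimplex ℝ (Fin (n + 1))

/-- The inclusion of a face of the standard simplex. -/
def face {n : ℕ} (j : Fin (n + 2)) : C(Simplex n, Simplex (n + 1)) :=
  ⟨stdSimplex.map j.succAbove, stdSimplex.continuous_map _⟩

/-- A function on singular simplices is a cocycle if it vanishes on boundaries. -/
def IsCocycle {n : ℕ} {X : Type u} [TopologicalSpace X] (F : C(Simplex n, X) → ℝ) : Prop :=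
  ∀ τ : C(Simplex (n + 1), X), ∑ j : Fin (n + 2), (-1 : ℝ) ^ (j : ℕ) * F (τ.comp (face j)) = 0

/-- The coefficients of integral singular homology. -/
abbrev Coeff : ModuleCat.{u} ℤ := ModuleCat.of ℤ (ULift.{u} ℤ)

/-- The singular chain complex. -/
abbrev singularChains (X : Type u) [TopologicalSpace X] : ChainComplex (ModuleCat.{u} ℤ) ℕ :=
  (TopCat.toSSet.obj (TopCat.of X)).chainComplex Coeff.{u}

/-- The generator of the singular chains given by a singular simplex. -/
def simplexChain {n : ℕ} {X : Type u} [TopologicalSpace X] (s : C(Simplex n, X)) :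
    Coeff.{u} ⟶ (singularChains X).X n :=
  SSet.ιChainComplex (X := TopCat.toSSet.obj (TopCat.of X)) (n := n)
    ((TopCat.toSSetObjEquiv (TopCat.of X) _).symm s)

theorem simplexChain_d {n : ℕ} {X : Type u} [TopologicalSpace X] (s : C(Simplex (n + 1), X)) :
    simplexChain s ≫ (singularChains X).d (n + 1) n =
      ∑ j : Fin (n + 2), (-1 : ℤ) ^ (j : ℕ) • simplexChain (s.comp (face j)) :=
  SSet.ιChainComplex_d (X := TopCat.toSSet.obj (TopCat.of X)) (R := Coeff.{u}) _

/-- The chain map induced by a continuous map. -/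
def singularChains.map {X Y : Type u} [TopologicalSpace X] [TopologicalSpace Y] (f : C(X, Y)) :
    singularChains X ⟶ singularChains Y :=
  SSet.chainComplexMap (TopCat.toSSet.map (TopCat.ofHom f)) Coeff.{u}

theorem simplexChain_map {n : ℕ} {X Y : Type u} [TopologicalSpace X] [TopologicalSpace Y]
    (f : C(X, Y)) (s : C(Simplex n, X)) :
    simplexChain s ≫ (singularChains.map f).f n = simplexChain (f.comp s) :=
  SSet.ι_chainComplexMap_f _ _ (TopCat.toSSet.map (TopCat.ofHom f)) Coeff.{u} _

variable {n : ℕ} {X Y : Type u} [TopologicalSpace X] [TopologicalSpace Y]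

/-- Multiplication by a real number, as a homomorphism on the coefficients. -/
def coeffHom : ℝ →+ (Coeff.{u} ⟶ ModuleCat.of ℤ (ULift.{u} ℝ)) where
  toFun x := ModuleCat.ofHom ((LinearMap.toSpanSingleton ℤ (ULift.{u} ℝ) ⟨x⟩).comp
    ULift.moduleEquiv.toLinearMap)
  map_zero' := by ext; simp
  map_add' x y := by ext; simp [mul_add]

theorem coeffHom_apply_one (x : ℝ) :
    ((coeffHom x).hom (ULift.up 1 : ULift.{u} ℤ) : ULift.{u} ℝ).down = x := by
  simp [coeffHom]

/-- The cochain with given values on the singular simplices. -/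
def cochainHom (F : C(Simplex n, X) → ℝ) :
    (singularChains X).X n ⟶ ModuleCat.of ℤ (ULift.{u} ℝ) :=
  Limits.Cofan.IsColimit.desc ((TopCat.toSSet.obj (TopCat.of X)).isColimitChainComplexXCofan
    Coeff.{u} n) fun s => coeffHom (F (TopCat.toSSetObjEquiv (TopCat.of X) _ s))

theorem simplexChain_cochainHom (F : C(Simplex n, X) → ℝ) (s : C(Simplex n, X)) :
    simplexChain s ≫ cochainHom F = coeffHom (F s) := by
  refine (Limits.Cofan.IsColimit.fac ((TopCat.toSSet.obj
    (TopCat.of X)).isColimitChainComplexXCofan Coeff.{u} n) _ _).trans ?_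
  rw [Equiv.apply_symm_apply]

theorem IsCocycle.d_comp {F : C(Simplex n, X) → ℝ} (hF : IsCocycle F) :
    (singularChains X).d (n + 1) n ≫ cochainHom F = 0 := by
  refine SSet.chainComplex_hom_ext fun x => ?_
  obtain ⟨s, rfl⟩ := (TopCat.toSSetObjEquiv (TopCat.of X) _).symm.surjective x
  change simplexChain s ≫ _ ≫ _ = simplexChain s ≫ 0
  rw [← Category.assoc, simplexChain_d, Preadditive.sum_comp, Limits.comp_zero]
  simp only [Preadditive.zsmul_comp, simplexChain_cochainHom, ← map_zsmul, ← map_sum]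
  rw [← map_zero coeffHom, ← hF s]
  simp

/-- Evaluation of a cocycle on homology classes. -/
def IsCocycle.eval {F : C(Simplex n, X) → ℝ} (hF : IsCocycle F) : H n X →ₗ[ℤ] ℝ :=
  ULift.moduleEquiv.toLinearMap.comp ((singularChains X).homologyι n ≫
    (singularChains X).descOpcycles (cochainHom F) (n + 1) (by simp) hF.d_comp).hom

/-- A finite integral combination of singular simplices. -/
def finiteChain {ι : Type*} [Fintype ι] (c : ι → ℤ) (s : ι → C(Simplex n, X)) :
    Coeff.{u} ⟶ (singularChains X).X n :=
  ∑ i, c i • simplexChain (s i)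

/-- Quantifying over all functions `F` of the faces makes the vanishing of the boundary a purely
combinatorial cancellation. -/
theorem finiteChain_d_eq_zero {ι : Type*} [Fintype ι] (c : ι → ℤ)
    (s : ι → C(Simplex (n + 1), X))
    (h : ∀ F : C(Simplex n, X) → (Coeff.{u} ⟶ (singularChains X).X n),
      ∑ i, c i • ∑ j : Fin (n + 2), (-1 : ℤ) ^ (j : ℕ) • F ((s i).comp (face j)) = 0) :
    finiteChain c s ≫ (singularChains X).d (n + 1) n = 0 := by
  rw [finiteChain, Preadditive.sum_comp]
  simp only [Preadditive.zsmul_comp, simplexChain_d]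
  exact h simplexChain

/-- The formula for evaluations is all that is later used about the class. Requiring the vanishing
for all `j` treats degree zero along with the others. -/
theorem exists_class_of_finiteChain {ι : Type*} [Fintype ι] (c : ι → ℤ) (s : ι → C(Simplex n, X))
    (h : ∀ j, finiteChain c s ≫ (singularChains X).d n j = 0) :
    ∃ z : H n X, ∀ (Y : Type u) [TopologicalSpace Y] (f : C(X, Y)) (F : C(Simplex n, Y) → ℝ)
      (hF : IsCocycle F), hF.eval (H.map n f z) = ∑ i, c i * F (f.comp (s i)) := by
  let z : Coeff.{u} ⟶ (singularChains X).homology n :=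
    (singularChains X).liftCycles (finiteChain c s) _ rfl (h _) ≫ (singularChains X).homologyπ n
  refine ⟨z.hom (ULift.up 1 : ULift.{u} ℤ), fun Y _ f F hF => ?_⟩
  have key : z ≫ HomologicalComplex.homologyMap (singularChains.map f) n ≫
      (singularChains Y).homologyι n ≫
        (singularChains Y).descOpcycles (cochainHom F) (n + 1) (by simp) hF.d_comp =
      coeffHom (∑ i, c i * F (f.comp (s i))) := by
    have : finiteChain c s ≫ (singularChains.map f).f n ≫ cochainHom F =
        coeffHom (∑ i, c i * F (f.comp (s i))) := by
      rw [finiteChain, Preadditive.sum_comp]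
      simp only [Preadditive.zsmul_comp, ← Category.assoc, simplexChain_map,
        simplexChain_cochainHom, ← map_zsmul, ← map_sum]
      simp
    simp only [z, Category.assoc, HomologicalComplex.homologyπ_naturality_assoc,
      HomologicalComplex.homology_π_ι_assoc, HomologicalComplex.p_descOpcycles, 
      HomologicalComplex.cyclesMap_i_assoc, HomologicalComplex.liftCycles_i_assoc, this]
  rw [← coeffHom_apply_one.{u} (∑ i, c i * F (f.comp (s i))), ← key]
  rfl

end Homology

/-! ## The crossing cocycle on unordered configuration spaces -/

section Covering

variable (I : Type*) (X : Type*)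

/-- Permutations act on labelled configurations. -/
@[reducible] def confMulAction : MulAction (Equiv.Perm I) (Conf I X) where
  smul σ c := ⟨c.1 ∘ σ.symm, c.2.comp σ.symm.injective⟩
  one_smul _ := rfl
  mul_smul _ _ _ := rfl

/-- Disjoint neighborhoods of the particles of `c` give a neighborhood of `c` that is disjoint from
its translates by nontrivial permutations. -/
theorem isCoveringMap_mk [Finite I] [TopologicalSpace X] [T2Space X] :
    IsCoveringMap (UConf.mk : Conf I X → UConf I X) := by
  let := confMulAction I X
  have smul_def : ∀ (σ : Equiv.Perm I) (c : Conf I X), (σ • c).1 = c.1 ∘ σ.symm := fun _ _ => rfl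
  have : IsQuotientCoveringMap (UConf.mk : Conf I X → UConf I X) (Equiv.Perm I) :=
    { UConf.isOpenQuotientMap_mk.isQuotientMap with
      continuous_const_smul := fun σ =>
        Continuous.subtype_mk ((Pi.continuous_precomp σ.symm).comp continuous_subtype_val) _
      apply_eq_iff_mem_orbit := by
        intro c d
        constructor
        · intro h
          obtain ⟨σ, hσ⟩ := UConf.mk_exact h.symm
          exact ⟨σ.symm, Subtype.ext hσ.symm⟩
        · rintro ⟨σ, rfl⟩
          exact (UConf.mk_eq σ.symm rfl).symm
      disjoint := by
        intro c
        obtain ⟨V, hV, hd⟩ := Pairwise.exists_mem_filter_of_disjoint (l := fun i => 𝓝 (c.1 i))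
          (fun i j hij => disjoint_nhds_nhds.2 (c.2.ne hij))
        refine ⟨{d | ∀ i, d.1 i ∈ V i}, ?_, fun σ => ?_⟩
        · exact eventually_all.2 fun i =>
            ((continuous_apply i).comp continuous_subtype_val).continuousAt.eventually (hV i)
        · rintro ⟨_, ⟨d, hd1, rfl⟩, hd2⟩
          refine Equiv.ext fun i => ?_
          by_contra hi
          have h1 := hd1 i
          have h2 := hd2 (σ i)
          simp only [smul_def, Function.comp_apply, Equiv.symm_apply_apply] at h2
          exact disjoint_left.1 (hd hi) h2 h1 }
  exact this.isCoveringMap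

variable {I X}

/-- A simplex is contractible and locally path connected, so its maps lift to the covering. -/
theorem exists_simplex_lift [Finite I] [TopologicalSpace X] [T2Space X] {n : ℕ}
    (τ : C(Simplex n, UConf I X)) :
    ∃ s : C(Simplex n, Conf I X), ∀ y, UConf.mk (s y) = τ y := by
  have : ContractibleSpace (Simplex n) :=
    (convex_stdSimplex ℝ (Fin (n + 1))).contractibleSpace ⟨_, single_mem_stdSimplex ℝ 0⟩
  have : LocallyPathConnectedSpace (Simplex n) :=
    (convex_stdSimplex ℝ (Fin (n + 1))).locallyPathConnectedSpace
  let y₀ : Simplex n := stdSimplex.vertex 0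
  obtain ⟨c, hc⟩ := Quotient.exists_rep (τ y₀)
  obtain ⟨s, ⟨-, hs⟩, -⟩ :=
    (isCoveringMap_mk I X).existsUnique_continuousMap_lifts τ y₀ c hc
  exact ⟨s, congrFun hs⟩

/-- A permutation that matches the two lifts at one point matches them everywhere, by uniqueness of
lifts. -/
theorem exists_perm_of_mk_eq [Finite I] [TopologicalSpace X] [T2Space X] {Y : Type*}
    [TopologicalSpace Y] [PreconnectedSpace Y] [Nonempty Y] {s s' : Y → Conf I X}
    (hs : Continuous s) (hs' : Continuous s') (h : ∀ y, UConf.mk (s y) = UConf.mk (s' y)) :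
    ∃ σ : Equiv.Perm I, ∀ y, (s' y).1 = (s y).1 ∘ σ := by
  obtain ⟨y₀⟩ := ‹Nonempty Y›
  obtain ⟨σ, hσ⟩ := UConf.mk_exact (h y₀)
  refine ⟨σ, fun y => ?_⟩
  have hc : Continuous fun y => (⟨(s y).1 ∘ σ, (s y).2.comp σ.injective⟩ : Conf I X) :=
    Continuous.subtype_mk ((Pi.continuous_precomp σ).comp (continuous_subtype_val.comp hs)) _
  have := (isCoveringMap_mk I X).eq_of_comp_eq hs' hc
    (funext fun y => (h y).symm.trans (UConf.mk_eq σ rfl)) y₀ (Subtype.ext hσ)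
  exact congrArg Subtype.val (congrFun this y)

end Covering

namespace CutData

variable {Γ : Type*} [TopologicalSpace Γ] [T2Space Γ] {m : ℕ} (D : CutData Γ m)
  {I : Type*} [Fintype I]

instance (n : ℕ) : PathConnectedSpace (Simplex n) :=
  isPathConnected_iff_pathConnectedSpace.1
    ((convex_stdSimplex ℝ (Fin (n + 1))).isPathConnected ⟨_, single_mem_stdSimplex ℝ 0⟩)

theorem exists_developed_lift {n : ℕ} (τ : C(Simplex n, UConf I Γ)) :
    ∃ (s : C(Simplex n, Conf I Γ)) (R A : Fin m → Simplex n → ℝ),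
      (∀ y, UConf.mk (s y) = τ y) ∧ D.IsDeveloping s R A := by
  obtain ⟨s, hs⟩ := exists_simplex_lift τ
  obtain ⟨R, A, h⟩ := D.exists_isDeveloping (convex_stdSimplex ℝ (Fin (n + 1)))
    (isCompact_stdSimplex ℝ _) s.continuous
  exact ⟨s, R, A, hs, h⟩

/-- The cochain that counts crossings of all the cut points. -/
def crossingCochain (τ : C(Simplex m, UConf I Γ)) : ℝ :=
  D.crossingNumber (D.exists_developed_lift τ).choose
    (D.exists_developed_lift τ).choose_spec.choose
    (D.exists_developed_lift τ).choose_spec.choose_spec.choose stdSimplex.vertex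

/-- The chosen lift differs from `s ∘ f` by a permutation, and the developing functions may be
replaced without effect. Hence developing functions on any parameter space, such as `ℝ ^ m` over the
torus, compute the cochain. -/
theorem IsDeveloping.crossingCochain_eq {D : CutData Γ m} {Y : Type*} [TopologicalSpace Y]
    {s : Y → Conf I Γ} {R A : Fin m → Y → ℝ} (h : D.IsDeveloping s R A) (hs : Continuous s)
    (f : C(Simplex m, Y)) (τ : C(Simplex m, UConf I Γ)) (hτ : ∀ y, τ y = UConf.mk (s (f y))) :
    D.crossingCochain τ = D.crossingNumber s R A fun i => f (stdSimplex.vertex i) := by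
  have spec := (D.exists_developed_lift τ).choose_spec.choose_spec.choose_spec
  obtain ⟨σ, hσ⟩ := exists_perm_of_mk_eq (hs.comp f.continuous)
    (D.exists_developed_lift τ).choose.continuous
    (fun y => (hτ y).symm.trans (spec.1 y).symm)
  have h1 := (h.comp f.continuous).perm σ hσ
  rw [crossingCochain, spec.2.crossingNumber_eq h1, crossingNumber_perm σ hσ]
  rfl

/-- One lift of `τ` with its developing functions computes the cochain on all faces at once. -/
theorem isCocycle_crossingCochain : IsCocycle (D.crossingCochain (I := I)) := by
  intro τ
  obtain ⟨s, R, A, hs, h⟩ := D.exists_developed_lift τ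
  rw [← h.sum_crossingNumber_succAbove s.continuous stdSimplex.vertex]
  refine Finset.sum_congr rfl fun j _ => ?_
  rw [h.crossingCochain_eq s.continuous (face j) _ fun y => (hs _).symm]
  congr 2
  funext i
  exact stdSimplex.map_vertex _ _

end CutData

/-! ## The fundamental cycle of the torus -/

section TorusCycle

theorem stdSimplex_map_sum {m n : ℕ} (f : Fin m → Fin n) (s : stdSimplex ℝ (Fin m))
    (c : Fin n → ℝ) : ∑ i, stdSimplex.map f s i * c i = ∑ k, s k * c (f k) := by
  have : ∀ i, stdSimplex.map f s i = ∑ k with f k = i, s k := fun i => by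
    rw [stdSimplex.map_coe, FunOnFinite.linearMap_apply_apply]
  simp only [this, Finset.sum_mul]
  rw [← Finset.sum_fiberwise Finset.univ f]
  refine Finset.sum_congr rfl fun i _ => Finset.sum_congr rfl fun k hk => ?_
  rw [(Finset.mem_filter.1 hk).2]

/-- The simplex of the standard triangulation of the cube whose vertices are
`0, e (π 0), e (π 0) + e (π 1), …`. -/
def cubeSimplex {m : ℕ} (π : Equiv.Perm (Fin m)) : C(Simplex m, Fin m → ℝ) where
  toFun s v := ∑ i, s i * if (π.symm v).castSucc < i then 1 else 0
  continuous_toFun := by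
    refine continuous_pi fun v => continuous_finsetSum _ fun i _ => ?_
    exact ((continuous_apply i).comp continuous_subtype_val).mul continuous_const

theorem cubeSimplex_vertex {m : ℕ} (π : Equiv.Perm (Fin m)) (i : Fin (m + 1)) (v : Fin m) :
    cubeSimplex π (stdSimplex.vertex i) v = if (π.symm v).castSucc < i then 1 else 0 := by
  change ∑ j, (Pi.single i (1 : ℝ) : Fin (m + 1) → ℝ) j * _ = _
  rw [Finset.sum_eq_single i]
  · simp
  · intro j _ hj
    simp [hj]
  · simp

theorem cubeSimplex_face {n : ℕ} (π : Equiv.Perm (Fin (n + 1))) (j : Fin (n + 2))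
    (s : Simplex n) (v : Fin (n + 1)) :
    cubeSimplex π (face j s) v =
      ∑ i, s i * if (π.symm v).castSucc < j.succAbove i then 1 else 0 :=
  stdSimplex_map_sum j.succAbove s fun i => if (π.symm v).castSucc < i then (1 : ℝ) else 0

/-- Swapping two consecutive coordinates changes only the vertex between the two steps, which this
face omits. -/
theorem cubeSimplex_swap_face {n : ℕ} (π : Equiv.Perm (Fin (n + 1))) (j : Fin n) :
    (cubeSimplex (π * Equiv.swap j.castSucc j.succ)).comp (face j.succ.castSucc) =
      (cubeSimplex π).comp (face j.succ.castSucc) := by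
  ext s v
  simp only [ContinuousMap.comp_apply, cubeSimplex_face]
  refine Finset.sum_congr rfl fun i _ => ?_
  congr 1
  refine if_congr ?_ rfl rfl
  have : (π * Equiv.swap j.castSucc j.succ).symm v =
      Equiv.swap j.castSucc j.succ (π.symm v) := rfl
  rw [this]
  generalize π.symm v = w
  rcases eq_or_ne w j.castSucc with rfl | h1
  · rw [Equiv.swap_apply_left]
    simp only [Fin.lt_def, Fin.succAbove, Fin.val_castSucc, Fin.val_succ]
    split_ifs <;> simp <;> omega
  · rcases eq_or_ne w j.succ with rfl | h2
    · rw [Equiv.swap_apply_right]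
      simp only [Fin.lt_def, Fin.succAbove, Fin.val_castSucc, Fin.val_succ]
      split_ifs <;> simp <;> omega
    · rw [Equiv.swap_apply_of_ne_of_ne h1 h2]

/-- The rotated path makes the step `e (π 0)` last instead of first. Without its end it is the path
of `π` without its start, translated by the lattice vector `-e (π 0)`. -/
theorem cubeSimplex_rotate_face {n : ℕ} (π : Equiv.Perm (Fin (n + 1))) (s : Simplex n)
    (v : Fin (n + 1)) :
    ((cubeSimplex (π * finRotate (n + 1)) (face (Fin.last (n + 1)) s) v : ℝ) : UnitAddCircle) =
      (cubeSimplex π (face 0 s) v : ℝ) := by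
  simp only [cubeSimplex_face, Fin.succAbove_last, Fin.succAbove_zero]
  have : (π * finRotate (n + 1)).symm v = (finRotate (n + 1)).symm (π.symm v) := rfl
  rw [this]
  generalize π.symm v = w
  -- The coordinate `π 0` is constantly `0` on one face and `1` on the other; all others agree.
  refine Fin.cases ?_ (fun w => ?_) w
  · have h0 : (finRotate (n + 1)).symm 0 = Fin.last n := by
      rw [Equiv.symm_apply_eq, finRotate_last]
    have hs : ∑ i, s i = 1 := s.2.2
    have h1 : ∀ i : Fin (n + 1), ¬ (Fin.last n).castSucc < i.castSucc := fun i => by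
      rw [Fin.castSucc_lt_castSucc_iff, not_lt]
      exact i.le_last
    have h2 : ∀ i : Fin (n + 1), (0 : Fin (n + 1)).castSucc < i.succ := fun i => by
      rw [Fin.castSucc_zero]; exact i.succ_pos
    simp only [h0, h1, h2, if_true, if_false, mul_one, mul_zero, Finset.sum_const_zero]
    rw [hs, AddCircle.coe_zero, AddCircle.coe_period]
  · have h0 : (finRotate (n + 1)).symm w.succ = w.castSucc := by
      rw [Equiv.symm_apply_eq]
      exact (finRotate_of_lt w.2).symm
    rw [h0]
    simp only [Fin.castSucc_lt_castSucc_iff, ← Fin.succ_castSucc, Fin.succ_lt_succ_iff]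

/-- The alternating sum of the simplices of a triangulated cube has no boundary once opposite faces
of the cube are identified. -/
theorem sum_sign_boundary_eq_zero {n : ℕ} {T : Type*} [TopologicalSpace T]
    (q : C(Fin (n + 1) → ℝ, T))
    (hq : ∀ θ θ', (∀ v, (θ v : UnitAddCircle) = θ' v) → q θ = q θ')
    {M : Type*} [AddCommGroup M] (F : C(Simplex n, T) → M) :
    ∑ π : Equiv.Perm (Fin (n + 1)), ((Equiv.Perm.sign π : ℤˣ) : ℤ) •
      ∑ j : Fin (n + 2), (-1 : ℤ) ^ (j : ℕ) • F ((q.comp (cubeSimplex π)).comp (face j)) = 0 := by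
  simp only [Finset.smul_sum]
  rw [Finset.sum_comm, Fin.sum_univ_succ, Fin.sum_univ_castSucc]
  have inner : ∀ j : Fin n, ∑ π : Equiv.Perm (Fin (n + 1)), ((Equiv.Perm.sign π : ℤˣ) : ℤ) •
      (-1 : ℤ) ^ (j.castSucc.succ : ℕ) •
        F ((q.comp (cubeSimplex π)).comp (face j.castSucc.succ)) = 0 := by
    intro j
    -- Inner faces cancel in pairs under an adjacent transposition, which is odd.
    refine Finset.sum_involution (fun π _ => π * Equiv.swap j.castSucc j.succ) ?_ ?_ ?_ ?_
    · intro π _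
      have h := cubeSimplex_swap_face π j
      rw [ContinuousMap.comp_assoc, ContinuousMap.comp_assoc, ← Fin.succ_castSucc] at *
      rw [h, Equiv.Perm.sign_mul, Equiv.Perm.sign_swap j.castSucc_lt_succ.ne]
      simp
    · intro π _ _ h
      have : Equiv.swap j.castSucc j.succ = 1 := by simpa using h
      exact j.castSucc_lt_succ.ne (Equiv.swap_eq_one_iff.1 this)
    · intro π _
      exact Finset.mem_univ _
    · intro π _
      simp [mul_assoc]
  rw [Finset.sum_eq_zero fun j _ => inner j, zero_add]
  -- The outer faces cancel: the rotation has sign `(-1) ^ n`, and the last face has index `n + 1`.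
  rw [← Equiv.sum_comp (Equiv.mulRight (finRotate (n + 1)))
    fun π => ((Equiv.Perm.sign π : ℤˣ) : ℤ) • (-1 : ℤ) ^ ((Fin.last n).succ : ℕ) •
        F ((q.comp (cubeSimplex π)).comp (face (Fin.last n).succ)), ← Finset.sum_add_distrib]
  refine Finset.sum_eq_zero fun π _ => ?_
  have h : (q.comp (cubeSimplex (π * finRotate (n + 1)))).comp (face (Fin.last n).succ) =
      (q.comp (cubeSimplex π)).comp (face 0) := by
    ext s
    exact hq _ _ fun v => cubeSimplex_rotate_face π s v
  simp only [Equiv.coe_mulRight, h, Equiv.Perm.sign_mul, sign_finRotate]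
  rw [smul_smul, smul_smul, ← add_smul]
  convert zero_smul ℤ _
  simp [pow_succ, mul_assoc, ← mul_pow]

/-- Only the simplex of the identity contributes to a product of functions of the coordinates. -/
theorem sum_sign_prod_cubeSimplex {m : ℕ} (α : Fin m → ℝ → ℝ) :
    ∑ π : Equiv.Perm (Fin m), (((Equiv.Perm.sign π : ℤˣ) : ℤ) : ℝ) *
      ∏ v : Fin m, (α v (cubeSimplex π (stdSimplex.vertex v.succ) v) -
        α v (cubeSimplex π (stdSimplex.vertex v.castSucc) v)) = ∏ v, (α v 1 - α v 0) := by
  rw [Finset.sum_eq_single 1]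
  · have : ∀ v : Fin m, (1 : Equiv.Perm (Fin m)).symm v = v := fun _ => rfl
    simp [cubeSimplex_vertex, this]
  · intro π _ hπ
    -- The `v`-th edge of the simplex moves only the coordinate `π v`, so the `v`-th factor vanishes
    -- unless `π v = v`.
    obtain ⟨v, hv⟩ : ∃ v, π.symm v ≠ v := by
      by_contra! h
      exact hπ (Equiv.ext fun v => (π.symm_apply_eq.1 (h v)).symm)
    refine mul_eq_zero_of_right _ (Finset.prod_eq_zero (Finset.mem_univ v) ?_)
    rw [sub_eq_zero, cubeSimplex_vertex, cubeSimplex_vertex]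
    congr 1
    refine if_congr ?_ rfl rfl
    rw [Fin.castSucc_lt_castSucc_iff, Fin.castSucc_lt_succ_iff]
    exact ⟨fun h => lt_of_le_of_ne h hv, le_of_lt⟩
  · simp

end TorusCycle

/-! ## The crossings of the canonical loop -/

section OrbitCrossings

/-- The center of a star. -/
def Star.center (n : ℕ) : Star n := ⟨0, fun _ => ⟨le_rfl, zero_le_one⟩, fun _ _ _ => Or.inl rfl⟩

theorem Star.eq_center_iff {n : ℕ} {s : Star n} : s = Star.center n ↔ ∀ i, s.1 i = 0 :=
  ⟨fun h i => by rw [h]; rfl, fun h => Subtype.ext (funext h)⟩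

theorem height_ne_zero_iff (i : Fin 3) (x : ℝ) :
    height i (x : UnitAddCircle) ≠ 0 ↔ ∃ N : ℤ, |x - (i : ℕ) / 3 - N| < 1 / 6 := by
  constructor
  · intro h
    have := norm_lt_of_height_ne h
    rw [← AddCircle.coe_sub, UnitAddCircle.norm_eq] at this
    exact ⟨_, this⟩
  · rintro ⟨N, hN⟩
    have : ‖(x : UnitAddCircle) - (((i : ℕ) / 3 : ℝ) : UnitAddCircle)‖ < 1 / 6 := by
      rw [← AddCircle.coe_sub, UnitAddCircle.norm_eq]
      exact (round_le _ N).trans_lt hN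
    refine (lt_of_lt_of_le ?_ (le_max_right _ _)).ne'
    exact lt_min one_pos (by linarith)

/-- The time of the loop, shifted so that the first particle is on leg `l + c` between the times
`c / 3` and `(c + 1) / 3`. -/
def legTime (l : Fin 3) (x : ℝ) : ℝ := x - (l : ℕ) / 3 + 1 / 6

theorem height_add_ne_zero_iff (l c : Fin 3) (x : ℝ) :
    height (l + c) (x : UnitAddCircle) ≠ 0 ↔
      ∃ N : ℤ, N + (c : ℕ) / 3 < legTime l x ∧ legTime l x < N + ((c : ℕ) + 1) / 3 := by
  rw [height_ne_zero_iff]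
  -- `d` is the carry in the addition modulo `3`.
  obtain ⟨d, hd⟩ : ∃ d : ℤ, (((l + c : Fin 3) : ℕ) : ℝ) = (l : ℕ) + (c : ℕ) - 3 * d := by
    fin_cases l <;> fin_cases c <;> first
      | (refine ⟨0, ?_⟩; norm_num [Fin.val_add]; done)
      | (refine ⟨1, ?_⟩; norm_num [Fin.val_add])
  rw [hd, legTime]
  constructor
  · rintro ⟨N, hN⟩
    rw [abs_lt] at hN
    refine ⟨N - d, ?_, ?_⟩ <;> push_cast <;> linarith
  · rintro ⟨N, hN⟩
    refine ⟨N + d, ?_⟩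
    rw [abs_lt]
    constructor <;> push_cast <;> linarith

theorem height_ne_zero_of_legTime {l : Fin 3} {x : ℝ} {N : ℤ} (h : N < legTime l x)
    (h' : legTime l x < N + 1 / 3) : height l (x : UnitAddCircle) ≠ 0 := by
  have := (height_add_ne_zero_iff l 0 x).2 ⟨N, by simpa using h, by simpa using h'⟩
  simpa using this

theorem height_eq_zero_of_legTime {l : Fin 3} {x : ℝ} {N : ℤ} (h : N + 1 / 3 ≤ legTime l x)
    (h' : legTime l x ≤ N + 1) : height l (x : UnitAddCircle) = 0 := by
  by_contra hc
  have := (height_add_ne_zero_iff l 0 x).1 (by simpa using hc)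
  obtain ⟨M, h1, h2⟩ := this
  simp only [Fin.val_zero, Nat.cast_zero, zero_div, add_zero, zero_add] at h1 h2
  have h3 : (M : ℝ) < (N + 1 : ℤ) := by push_cast; linarith
  have h4 : (N : ℝ) < M := by linarith
  have h3' : M < N + 1 := by exact_mod_cast h3
  have h4' : N < M := by exact_mod_cast h4
  omega

theorem ceil_legTime {l : Fin 3} {x : ℝ} {N : ℤ} (h : N < legTime l x)
    (h' : legTime l x ≤ N + 1) : ⌈legTime l x⌉ = N + 1 := by
  rw [Int.ceil_eq_iff]
  push_cast
  exact ⟨by linarith, h'⟩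

theorem continuous_legTime (l : Fin 3) : Continuous (legTime l) := by
  unfold legTime
  fun_prop

/-- The position of the first particle as a function of real time. -/
abbrev particlePath (x : ℝ) : Star 3 := firstParticle (x : UnitAddCircle)

theorem continuous_particlePath : Continuous particlePath :=
  continuous_firstParticle.comp (AddCircle.continuous_mk' 1)

theorem particlePath_add_one (x : ℝ) : particlePath (x + 1) = particlePath x := by
  unfold particlePath
  rw [AddCircle.coe_add, AddCircle.coe_period, add_zero]

open Classical in
/-- The weighted number of passages of the first particle through the center between leg `l` and
the other legs, up to time `x`. -/
def passages (l : Fin 3) (a b : ℝ) (x : ℝ) : ℝ :=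
  (a - b) * ⌈legTime l x⌉ + if height l (x : UnitAddCircle) ≠ 0 then b else 0

theorem passages_add_one (l : Fin 3) (a b x : ℝ) :
    passages l a b (x + 1) = passages l a b x + (a - b) := by
  have : legTime l (x + 1) = legTime l x + 1 := by unfold legTime; ring
  unfold passages
  rw [this, Int.ceil_add_one, AddCircle.coe_add, AddCircle.coe_period, add_zero]
  push_cast
  ring

/-- This value is `(a - b) * N + a`: entering the leg adds `a`, and leaving it subtracts `b`. The
ceiling assigns the moment of entering itself to the time before, when the particle is not yet on
the leg. -/
theorem passages_of_lt {l : Fin 3} {a b x : ℝ} {N : ℤ} (h : N < legTime l x)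
    (h' : legTime l x < N + 1 / 3) : passages l a b x = (a - b) * (N + 1) + b := by
  rw [passages, if_pos (height_ne_zero_of_legTime h h'), ceil_legTime h (by linarith)]
  push_cast
  rfl

theorem passages_of_le {l : Fin 3} {a b x : ℝ} {N : ℤ} (h : N + 1 / 3 ≤ legTime l x)
    (h' : legTime l x ≤ N + 1) : passages l a b x = (a - b) * (N + 1) := by
  rw [passages, if_neg (by simpa using height_eq_zero_of_legTime h h'),
    ceil_legTime (by linarith) h']
  push_cast
  ring

-- The other particle is half a turn ahead: it is on leg `l + 1` when this one enters leg `l`, and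
-- on leg `l + 2` when this one leaves it. Hence the two coefficients.
open Classical in
theorem eventually_passages_sub (l : Fin 3) (w : Star 3 → ℝ) (τ : Fin 3 → ℝ)
    (hw : ∀ s c, s.1 c ≠ 0 → w s = τ c) (x : ℝ) :
    ∀ᶠ x' in 𝓝 x,
      passages l (Real.exp (w (Star.center 3) + τ (l + 1)))
          (Real.exp (w (Star.center 3) + τ (l + 2))) x' -
        passages l (Real.exp (w (Star.center 3) + τ (l + 1)))
          (Real.exp (w (Star.center 3) + τ (l + 2))) x =
      if particlePath x = Star.center 3 then
        Real.exp (w (particlePath x) + w (particlePath (x + 1 / 2))) *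
          if height l (x' : UnitAddCircle) ≠ 0 then 1 else 0
      else 0 := by
  generalize ha : Real.exp (w (Star.center 3) + τ (l + 1)) = a
  generalize hb : Real.exp (w (Star.center 3) + τ (l + 2)) = b
  -- In the turn `(N, N + 1]` the function jumps on leaving the leg at `N + 1 / 3` and on entering
  -- it again at `N + 1`.
  obtain ⟨N, hN1, hN2⟩ : ∃ N : ℤ, N < legTime l x ∧ legTime l x ≤ N + 1 :=
    ⟨⌈legTime l x⌉ - 1, by
      push_cast
      linarith [Int.ceil_lt_add_one (legTime l x)], by
      push_cast
      linarith [Int.le_ceil (legTime l x)]⟩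
  have cont := (continuous_legTime l).continuousAt (x := x)
  have ev : ∀ u v : ℝ, u < legTime l x → legTime l x < v →
      ∀ᶠ x' in 𝓝 x, u < legTime l x' ∧ legTime l x' < v := fun u v hu hv =>
    (cont.eventually (lt_mem_nhds hu)).and (cont.eventually (gt_mem_nhds hv))
  have hhalf : legTime l (x + 1 / 2) = legTime l x + 1 / 2 := by unfold legTime; ring
  have ne_center : ∀ c, height c (x : UnitAddCircle) ≠ 0 → particlePath x ≠ Star.center 3 :=
    fun c hc h => hc (Star.eq_center_iff.1 h c)
  rcases lt_trichotomy (legTime l x) (N + 1 / 3) with h | h | h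
  · filter_upwards [ev _ _ hN1 h] with x' hx'
    rw [passages_of_lt hN1 h, passages_of_lt hx'.1 hx'.2,
      if_neg (ne_center l (height_ne_zero_of_legTime hN1 h)), sub_self]
  · have hc : particlePath x = Star.center 3 := by
      refine Star.eq_center_iff.2 fun c => ?_
      by_contra hc
      obtain ⟨d, rfl⟩ : ∃ d, c = l + d := ⟨c - l, by abel⟩
      obtain ⟨M, h1, h2⟩ := (height_add_ne_zero_iff l d x).1 hc
      rw [h] at h1 h2
      have h3 : ((3 * M + (d : ℕ) : ℤ) : ℝ) < (3 * N + 1 : ℤ) := by push_cast; linarith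
      have h4 : ((3 * N + 1 : ℤ) : ℝ) < (3 * M + (d : ℕ) + 1 : ℤ) := by push_cast; linarith
      have h3' := Int.cast_lt.1 h3
      have h4' := Int.cast_lt.1 h4
      omega
    have hw' : w (particlePath (x + 1 / 2)) = τ (l + 2) := by
      refine hw _ _ ((height_add_ne_zero_iff l 2 _).2 ⟨N, ?_, ?_⟩)
      · rw [hhalf, h]; norm_num; linarith
      · rw [hhalf, h]; norm_num; linarith
    filter_upwards [ev N (N + 1) hN1 (by linarith)] with x' hx'
    rw [if_pos hc, hw', hc, hb, passages_of_le h.ge hN2]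
    rcases lt_or_ge (legTime l x') (N + 1 / 3) with h' | h'
    · rw [passages_of_lt hx'.1 h', if_pos (height_ne_zero_of_legTime hx'.1 h')]
      ring
    · rw [passages_of_le h' hx'.2.le, if_neg (by simpa using height_eq_zero_of_legTime h' hx'.2.le)]
      ring
  · rcases hN2.lt_or_eq with h2 | h2
    -- At `N + 2 / 3` the particle is at the center too, but it passes between the other two legs,
    -- so both sides vanish.
    · filter_upwards [ev _ _ h h2] with x' hx'
      rw [passages_of_le h.le hN2, passages_of_le hx'.1.le hx'.2.le]
      simp [height_eq_zero_of_legTime hx'.1.le hx'.2.le]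
    · have hc : particlePath x = Star.center 3 := by
        refine Star.eq_center_iff.2 fun c => ?_
        by_contra hc
        obtain ⟨d, rfl⟩ : ∃ d, c = l + d := ⟨c - l, by abel⟩
        obtain ⟨M, h1, h2'⟩ := (height_add_ne_zero_iff l d x).1 hc
        rw [h2] at h1 h2'
        have h3 : ((3 * M + (d : ℕ) : ℤ) : ℝ) < (3 * N + 3 : ℤ) := by push_cast; linarith
        have h4 : ((3 * N + 3 : ℤ) : ℝ) < (3 * M + (d : ℕ) + 1 : ℤ) := by push_cast; linarith
        have h3' := Int.cast_lt.1 h3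
        have h4' := Int.cast_lt.1 h4
        omega
      have hw' : w (particlePath (x + 1 / 2)) = τ (l + 1) := by
        refine hw _ _ ((height_add_ne_zero_iff l 1 _).2 ⟨N + 1, ?_, ?_⟩)
        · rw [hhalf, h2]; norm_num
        · rw [hhalf, h2]; norm_num
      filter_upwards [ev (N + 1 / 3) (N + 1 + 1 / 3) h (by linarith)] with x' hx'
      rw [if_pos hc, hw', hc, ha, passages_of_le h.le hN2]
      rcases le_or_gt (legTime l x') (N + 1) with h' | h'
      · rw [passages_of_le hx'.1.le h', if_neg (by simpa using height_eq_zero_of_legTime hx'.1.le h')]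
        ring
      · have e1 : ((N + 1 : ℤ) : ℝ) < legTime l x' := by push_cast; exact h'
        have e2 : legTime l x' < ((N + 1 : ℤ) : ℝ) + 1 / 3 := by push_cast; exact hx'.2
        rw [passages_of_lt e1 e2, if_pos (height_ne_zero_of_legTime e1 e2)]
        push_cast
        ring

end OrbitCrossings

/-! ## The crossing number of a torus -/

section TorusCrossing

universe u

variable {A : Type u} {r : ℕ} {Γ : Type*} [TopologicalSpace Γ] {k m : ℕ}

/-- Cut points at the centers of the stars of a torus, such that the weights are constant on the
legs and the crossing functions are the indicator functions of the legs `leg a`. -/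
structure IsAdapted (D : CutData Γ m) (φ : Stars A r → Γ) (ε : A ≃ Fin m) (leg : A → Fin 3)
    (τ : A → Fin 3 → ℝ) : Prop where
  center : ∀ a, φ ⟨Sum.inl a, Star.center 3⟩ = D.pt (ε a)
  t_leg : ∀ a (s : Star 3) c, s.1 c ≠ 0 → D.t (φ ⟨Sum.inl a, s⟩) = τ a c
  χ_leg : ∀ a, ∀ᶠ s : Star 3 in 𝓝 (Star.center 3),
    D.χ (ε a) (φ ⟨Sum.inl a, s⟩) = if s.1 (leg a) ≠ 0 then 1 else 0
  ne : ∀ a, τ a (leg a + 1) ≠ τ a (leg a + 2)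

/-- The torus as a function of real angles. -/
def realTorus (φ : Stars A r → Γ) (hφ : IsEmbedding φ) (e : Particle A r ≃ Fin k) (ε : A ≃ Fin m)
    (θ : Fin m → ℝ) : Conf (Fin k) Γ :=
  torus φ hφ e fun a => (θ (ε a) : UnitAddCircle)

theorem continuous_realTorus (φ : Stars A r → Γ) (hφ : IsEmbedding φ) (e : Particle A r ≃ Fin k)
    (ε : A ≃ Fin m) : Continuous (realTorus φ hφ e ε) :=
  (torus φ hφ e).continuous.comp
    (continuous_pi fun a => (AddCircle.continuous_mk' 1).comp (continuous_apply (ε a)))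

/-- The stars have disjoint images, so only the two particles orbiting at `a` contribute. -/
theorem sum_realTorus (φ : Stars A r → Γ) (hφ : IsEmbedding φ) (e : Particle A r ≃ Fin k)
    (ε : A ≃ Fin m) (a : A) (G : Γ → Γ → ℝ)
    (hG : ∀ p q, p ∉ range (fun s : Star 3 => φ ⟨Sum.inl a, s⟩) → G p q = 0) (θ θ' : Fin m → ℝ) :
    ∑ i, G ((realTorus φ hφ e ε θ).1 i) ((realTorus φ hφ e ε θ').1 i) =
      G (φ ⟨Sum.inl a, particlePath (θ (ε a))⟩) (φ ⟨Sum.inl a, particlePath (θ' (ε a))⟩) +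
      G (φ ⟨Sum.inl a, particlePath (θ (ε a) + 1 / 2)⟩)
        (φ ⟨Sum.inl a, particlePath (θ' (ε a) + 1 / 2)⟩) := by
  classical
  have : Fintype A := Fintype.ofEquiv _ ε.symm
  have hval : ∀ (θ : Fin m → ℝ) (p : Particle A r), (realTorus φ hφ e ε θ).1 (e p) =
      φ ⟨p.1, (orbits A r (fun a => (θ (ε a) : UnitAddCircle)) p.1).1 p.2⟩ := by
    intro θ p
    change φ ⟨(e.symm (e p)).1, _⟩ = _
    rw [e.symm_apply_apply]
  rw [← e.sum_comp]
  simp only [hval]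
  rw [Fintype.sum_sigma, Finset.sum_eq_single (Sum.inl a)]
  · change ∑ j : Fin 2, _ = _
    rw [Fin.sum_univ_two]
    have hh : ∀ x : ℝ, ((x + 1 / 2 : ℝ) : UnitAddCircle) = (x : UnitAddCircle) + half := fun x => by
      rw [AddCircle.coe_add, half]
    simp only [particlePath, hh]
    rfl
  · intro b _ hb
    refine Finset.sum_eq_zero fun j _ => hG _ _ ?_
    rintro ⟨s, hs⟩
    exact hb (congrArg Sigma.fst (hφ.injective hs)).symm
  · simp

variable {D : CutData Γ m} {φ : Stars A r → Γ} {ε : A ≃ Fin m} {leg : A → Fin 3}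
  {τ : A → Fin 3 → ℝ}

/-- The developing function that records the weight of the particles orbiting at `a`. -/
def pairWeight (D : CutData Γ m) (φ : Stars A r → Γ) (a : A) (x : ℝ) : ℝ :=
  D.t (φ ⟨Sum.inl a, particlePath x⟩) + D.t (φ ⟨Sum.inl a, particlePath (x + 1 / 2)⟩)

/-- The developing function that records the crossings of the particles orbiting at `a`. -/
def pairPassages (D : CutData Γ m) (ε : A ≃ Fin m) (leg : A → Fin 3) (τ : A → Fin 3 → ℝ) (a : A)
    (x : ℝ) : ℝ :=
  let f := passages (leg a) (Real.exp (D.t (D.pt (ε a)) + τ a (leg a + 1)))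
    (Real.exp (D.t (D.pt (ε a)) + τ a (leg a + 2)))
  f x + f (x + 1 / 2)

/-- Each of the two particles contributes one period of `passages`. -/
theorem pairPassages_one_sub_zero (a : A) :
    pairPassages D ε leg τ a 1 - pairPassages D ε leg τ a 0 =
      2 * (Real.exp (D.t (D.pt (ε a)) + τ a (leg a + 1)) -
        Real.exp (D.t (D.pt (ε a)) + τ a (leg a + 2))) := by
  unfold pairPassages
  have h1 := passages_add_one (leg a) (Real.exp (D.t (D.pt (ε a)) + τ a (leg a + 1)))
    (Real.exp (D.t (D.pt (ε a)) + τ a (leg a + 2))) 0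
  have h2 := passages_add_one (leg a) (Real.exp (D.t (D.pt (ε a)) + τ a (leg a + 1)))
    (Real.exp (D.t (D.pt (ε a)) + τ a (leg a + 2))) (1 / 2)
  have e1 : (1 : ℝ) + 1 / 2 = 1 / 2 + 1 := by norm_num
  simp only [zero_add] at h1 ⊢
  rw [e1, h1, h2]
  ring

theorem particlePath_half_ne {x : ℝ} (h : particlePath x = Star.center 3) :
    particlePath (x + 1 / 2) ≠ Star.center 3 := by
  intro h'
  have := firstParticle_ne (x : UnitAddCircle)
  rw [half, ← AddCircle.coe_add] at this
  exact this (h.trans h'.symm)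

/-- A particle orbiting at `a` meets no cut point other than the center of its star. So the
developing functions can be chosen to depend on a single coordinate each, which turns the cup
product into a product of periods. -/
theorem IsAdapted.isDeveloping (hD : IsAdapted D φ ε leg τ) (hφ : IsEmbedding φ)
    (e : Particle A r ≃ Fin k) :
    D.IsDeveloping (realTorus φ hφ e ε) (fun v θ => pairWeight D φ (ε.symm v) (θ v))
      (fun v θ => pairPassages D ε leg τ (ε.symm v) (θ v)) := by
  classical
  have eq_pt : ∀ a (s : Star 3), φ ⟨Sum.inl a, s⟩ = D.pt (ε a) ↔ s = Star.center 3 := by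
    intro a s
    rw [← hD.center a]
    refine ⟨fun h => ?_, fun h => by rw [h]⟩
    exact eq_of_heq (Sigma.mk.inj_iff.1 (hφ.injective h)).2
  have ne_pt : ∀ a (s : Star 3), s ≠ Star.center 3 → ∀ v, φ ⟨Sum.inl a, s⟩ ≠ D.pt v := by
    intro a s hs v h
    obtain ⟨b, rfl⟩ := ε.surjective v
    rw [← hD.center b] at h
    have := Sigma.mk.inj_iff.1 (hφ.injective h)
    obtain rfl : a = b := Sum.inl_injective this.1
    exact hs (eq_of_heq this.2)
  have not_range : ∀ a p, p ∉ range (fun s : Star 3 => φ ⟨Sum.inl a, s⟩) → p ≠ D.pt (ε a) := by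
    rintro a p hp rfl
    exact hp ⟨Star.center 3, hD.center a⟩
  have cont : ∀ a, Continuous fun s : Star 3 => φ ⟨Sum.inl a, s⟩ := fun a =>
    hφ.continuous.comp (continuous_sigmaMk (σ := fun a => Star (legs A r a)) (i := Sum.inl a))
  have cont_half : Continuous fun x : ℝ => particlePath (x + 1 / 2) :=
    continuous_particlePath.comp (continuous_id.add continuous_const)
  constructor
  · intro v θ
    obtain ⟨a, rfl⟩ := ε.surjective v
    simp only [Equiv.symm_apply_apply]
    have step : ∀ p : ℝ → Star 3, Continuous p → ∀ x, ∀ᶠ y in 𝓝 x,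
        (if p x = Star.center 3 then D.t (φ ⟨Sum.inl a, p y⟩) - D.t (D.pt (ε a)) else 0) =
          D.t (φ ⟨Sum.inl a, p y⟩) - D.t (φ ⟨Sum.inl a, p x⟩) := by
      intro p hp x
      by_cases h : p x = Star.center 3
      · refine Eventually.of_forall fun y => ?_
        rw [if_pos h, h, hD.center]
      · have := ((cont a).comp hp).continuousAt.eventually (D.eventually_t _ (ne_pt a _ h))
        filter_upwards [this] with y hy
        rw [if_neg h]
        exact (sub_eq_zero.2 hy).symm
    have h1 := (continuous_apply (ε a)).continuousAt.eventually
      (step _ continuous_particlePath (θ (ε a)))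
    have h2 := (continuous_apply (ε a)).continuousAt.eventually (step _ cont_half (θ (ε a)))
    filter_upwards [h1, h2] with θ' h1 h2
    rw [CutData.weightForm, sum_realTorus φ hφ e ε a
      (fun p q => if p = D.pt (ε a) then D.t q - D.t (D.pt (ε a)) else 0)
      (fun p q hp => if_neg (not_range a p hp))]
    simp only [eq_pt, h1, h2, pairWeight]
    ring
  · intro v θ
    obtain ⟨a, rfl⟩ := ε.surjective v
    simp only [Equiv.symm_apply_apply]
    have step : ∀ (p : ℝ → Star 3) (s : ℝ), (∀ x, p x = particlePath (x + s)) → ∀ x,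
        ∀ᶠ y in 𝓝 x,
        (if p x = Star.center 3 then D.χ (ε a) (φ ⟨Sum.inl a, p y⟩) else 0) =
          if p x = Star.center 3 then
            (if height (leg a) ((y + s : ℝ) : UnitAddCircle) ≠ 0 then 1 else 0) else 0 := by
      intro p s hp x
      by_cases h : p x = Star.center 3
      · have hpc : Continuous p := by
          rw [funext hp]
          exact continuous_particlePath.comp (continuous_id.add continuous_const)
        have := hD.χ_leg a
        rw [← h] at this
        filter_upwards [hpc.continuousAt.eventually this] with y hy
        rw [if_pos h, if_pos h, hy, hp y]
        rfl
      · exact Eventually.of_forall fun y => by rw [if_neg h, if_neg h]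
    -- While one particle is at the center, the weight of the pair is the exponent of the
    -- coefficients in `passages`.
    have ev := fun x => eventually_passages_sub (leg a) (fun s => D.t (φ ⟨Sum.inl a, s⟩)) (τ a)
      (hD.t_leg a) x
    simp only [hD.center] at ev
    have shift : Continuous fun x : ℝ => x + 1 / 2 := continuous_id.add continuous_const
    have ca := (continuous_apply (A := fun _ : Fin m => ℝ) (ε a)).continuousAt (x := θ)
    filter_upwards [ca.eventually (ev (θ (ε a))),
      ca.eventually (shift.continuousAt.eventually (ev (θ (ε a) + 1 / 2))),
      ca.eventually (step particlePath 0 (fun x => by rw [add_zero]) (θ (ε a))),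
      ca.eventually (step (fun x => particlePath (x + 1 / 2)) (1 / 2) (fun x => rfl) (θ (ε a)))]
      with θ' e1 e2 h1 h2
    rw [CutData.crossForm, sum_realTorus φ hφ e ε a
      (fun p q => if p = D.pt (ε a) then D.χ (ε a) q else 0)
      (fun p q hp => if_neg (not_range a p hp))]
    simp only [eq_pt, h1, h2, pairWeight, pairPassages]
    rw [add_sub_add_comm, e1, e2]
    -- Half a turn ahead of the second particle is the first one, a full turn later.
    have hper : θ (ε a) + 1 / 2 + 1 / 2 = θ (ε a) + 1 := by ring
    rw [hper, particlePath_add_one, add_zero]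
    by_cases hc : particlePath (θ (ε a)) = Star.center 3
    · rw [if_pos hc, if_pos hc, if_neg (particlePath_half_ne hc), if_neg (particlePath_half_ne hc)]
      ring
    · rw [if_neg hc, if_neg hc]
      by_cases hc' : particlePath (θ (ε a) + 1 / 2) = Star.center 3
      · rw [if_pos hc', if_pos hc', add_comm (D.t _)]
        ring
      · rw [if_neg hc', if_neg hc']
        ring

/-- The crossing cocycle is nonzero on the fundamental cycle of an adapted torus. -/
theorem IsAdapted.sum_crossingCochain_ne_zero [T2Space Γ] (hD : IsAdapted D φ ε leg τ) (hφ : IsEmbedding φ)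
    (e : Particle A r ≃ Fin k) (q : Equiv.Perm (Fin m) → C(Simplex m, UConf (Fin k) Γ))
    (hq : ∀ π y, q π y = UConf.mk (realTorus φ hφ e ε (cubeSimplex π y))) :
    ∑ π, (((Equiv.Perm.sign π : ℤˣ) : ℤ) : ℝ) * D.crossingCochain (q π) ≠ 0 := by
  have dev := hD.isDeveloping hφ e
  have cont := continuous_realTorus φ hφ e ε
  have h1 : ∀ π, D.crossingCochain (q π) = _ := fun π =>
    dev.crossingCochain_eq cont (cubeSimplex π) (q π) (hq π)
  have h2 : ∀ π : Equiv.Perm (Fin m), ∀ c : ℝ, c * D.crossingNumber (realTorus φ hφ e ε)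
      (fun v θ => pairWeight D φ (ε.symm v) (θ v))
      (fun v θ => pairPassages D ε leg τ (ε.symm v) (θ v))
      (fun i => cubeSimplex π (stdSimplex.vertex i)) =
      Real.exp (D.weight (realTorus φ hφ e ε 0) - ∑ v, pairWeight D φ (ε.symm v) 0) *
        (c * ∏ v : Fin m, (pairPassages D ε leg τ (ε.symm v)
          (cubeSimplex π (stdSimplex.vertex v.succ) v) -
        pairPassages D ε leg τ (ε.symm v)
          (cubeSimplex π (stdSimplex.vertex v.castSucc) v))) := by
    intro π c
    -- The exponential factor is constant, so it is evaluated at the origin and leaves the sum.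
    have := dev.weight_sub_eq cont (cubeSimplex π (stdSimplex.vertex 0)) 0
    simp only [Pi.zero_apply] at this
    rw [CutData.crossingNumber, this]
    ring
  simp only [h1, h2]
  rw [← Finset.mul_sum, sum_sign_prod_cubeSimplex]
  refine mul_ne_zero (Real.exp_ne_zero _) (Finset.prod_ne_zero_iff.2 fun v _ => ?_)
  rw [pairPassages_one_sub_zero]
  refine mul_ne_zero two_ne_zero (sub_ne_zero.2 fun h => hD.ne (ε.symm v) ?_)
  simpa using Real.exp_injective h

end TorusCrossing

/-! ### From a nonzero evaluation to infinite order -/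

section InfiniteOrder

universe u

theorem H.map_comp (n : ℕ) {X Y Z : Type u} [TopologicalSpace X] [TopologicalSpace Y]
    [TopologicalSpace Z] (g : C(Y, Z)) (f : C(X, Y)) (x : H n X) :
    H.map n (g.comp f) x = H.map n g (H.map n f x) := by
  unfold H.map
  rw [TopCat.ofHom_comp, Functor.map_comp]
  rfl

/-- As `y` is a multiple of `x`, the value at `f x` is nonzero too. So the explicit cycle need not
be known to be a generator, and it may even be pushed forward by a map of higher degree. -/
theorem not_isOfFinAddOrder_of_eval {M N : Type*} [AddCommGroup M] [AddCommGroup N] [Module ℤ M]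
    [Module ℤ N] (f : M →ₗ[ℤ] N) (g : N →ₗ[ℤ] ℝ) {x y : M} (hx : Submodule.span ℤ {x} = ⊤)
    (h : g (f y) ≠ 0) : ¬ IsOfFinAddOrder (f x) := by
  intro hf
  have h0 : g (f x) = 0 :=
    isOfFinAddOrder_iff_eq_zero _ |>.1 (g.toAddMonoidHom.isOfFinAddOrder hf)
  obtain ⟨n, rfl⟩ := Submodule.mem_span_singleton.1 (hx ▸ Submodule.mem_top : y ∈ _)
  refine h (((congrArg g (f.map_smul n x)).trans (g.map_smul n (f x))).trans ?_)
  rw [h0, smul_zero]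

variable {A Γ : Type u} [TopologicalSpace Γ] [T2Space Γ] {r k : ℕ}

/-- Doubling all the angles. -/
def doubling (A : Type u) : C(A → UnitAddCircle, A → UnitAddCircle) :=
  ⟨fun θ a => 2 • θ a, by fun_prop⟩

omit [T2Space Γ] in
-- The image of the ordered loop runs twice through the unordered one.
theorem utorus_doubling (φ : Stars A r → Γ) (hφ : IsEmbedding φ) (e : Particle A r ≃ Fin k)
    (θ : A → UnitAddCircle) :
    utorus φ hφ e (doubling A θ) = UConf.mk (torus φ hφ e θ) := by
  have h : uorbits A r (doubling A θ) = fun a => UConf.mk (orbits A r θ a) := by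
    funext a
    rcases a with a | s
    · exact uorbit_two_nsmul (θ a)
    · rfl
  change UConf.map (Fin k) _ _ (UConf.reindex _ e (UConf.sigma (uorbits A r (doubling A θ)))) = _
  rw [h, UConf.sigma_mk]
  rfl

/-- The angles given by real numbers. -/
def realAngles {m : ℕ} (ε : A ≃ Fin m) : C(Fin m → ℝ, A → UnitAddCircle) :=
  ⟨fun θ a => (θ (ε a) : UnitAddCircle),
    continuous_pi fun a => (AddCircle.continuous_mk' 1).comp (continuous_apply (ε a))⟩

theorem finiteChain_torus_d {m : ℕ} (ε : A ≃ Fin m) (j : ℕ) :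
    finiteChain (fun π : Equiv.Perm (Fin m) => ((Equiv.Perm.sign π : ℤˣ) : ℤ))
      (fun π => (realAngles ε).comp (cubeSimplex π)) ≫
        (singularChains (A → UnitAddCircle)).d m j = 0 := by
  by_cases hj : j + 1 = m
  · subst hj
    refine finiteChain_d_eq_zero _ _ fun F => sum_sign_boundary_eq_zero (realAngles ε) ?_ F
    intro θ θ' h
    exact funext fun a => h (ε a)
  · rw [HomologicalComplex.shape _ _ _ (by simpa using hj), Limits.comp_zero]

/-- The map from the torus to `B_k(Γ)` factors both through `torus` and, after doubling the angles,
through `utorus`. A single evaluation therefore serves both claims. -/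
theorem IsAdapted.not_isOfFinAddOrder {D : CutData Γ (Nat.card A)} {φ : Stars A r → Γ}
    {ε : A ≃ Fin (Nat.card A)} {leg : A → Fin 3} {τ : A → Fin 3 → ℝ}
    (hD : IsAdapted D φ ε leg τ) (hφ : IsEmbedding φ) (e : Particle A r ≃ Fin k)
    {x : H (Nat.card A) (A → UnitAddCircle)} (hx : IsFundamentalClass A x) :
    ¬ IsOfFinAddOrder (H.map _ (utorus φ hφ e) x) ∧
      ¬ IsOfFinAddOrder (H.map _ (torus φ hφ e) x) := by
  obtain ⟨z, hz⟩ := exists_class_of_finiteChain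
    (fun π : Equiv.Perm (Fin (Nat.card A)) => ((Equiv.Perm.sign π : ℤˣ) : ℤ))
    (fun π => (realAngles ε).comp (cubeSimplex π)) (finiteChain_torus_d ε)
  let mk : C(Conf (Fin k) Γ, UConf (Fin k) Γ) := ⟨UConf.mk, UConf.continuous_mk⟩
  have hF := D.isCocycle_crossingCochain (I := Fin k)
  have main : hF.eval (H.map _ (mk.comp (torus φ hφ e)) z) ≠ 0 := by
    rw [hz]
    exact hD.sum_crossingCochain_ne_zero hφ e _ fun π y => rfl
  have hdouble : mk.comp (torus φ hφ e) = (utorus φ hφ e).comp (doubling A) :=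
    ContinuousMap.ext fun θ => (utorus_doubling φ hφ e θ).symm
  constructor
  · rw [hdouble, H.map_comp] at main
    exact not_isOfFinAddOrder_of_eval _ hF.eval hx main
  · rw [H.map_comp] at main
    exact not_isOfFinAddOrder_of_eval _ (hF.eval.comp (H.map _ mk)) hx main

end InfiniteOrder

/-! ## Star-shaped neighborhoods -/

/-- A neighborhood of `x` that is an open star with center `x` and arms indexed by `ι`. -/
structure LocalStar {Γ : Type*} [TopologicalSpace Γ] (x : Γ) (ι : Type*) where
  arm : ι → ℝ → Γ
  arm_zero : ∀ h, arm h 0 = x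
  arm_inj : ∀ h h' s s', s ∈ Ioo (0 : ℝ) 1 → s' ∈ Ioo (0 : ℝ) 1 → arm h s = arm h' s' →
    h = h' ∧ s = s'
  arm_ne : ∀ h s, s ∈ Ioo (0 : ℝ) 1 → arm h s ≠ x
  continuousOn : ∀ h, ContinuousOn (arm h) (Ico 0 1)
  isOpen_image : ∀ h J, IsOpen J → J ⊆ Ioo 0 1 → IsOpen (arm h '' J)
  isOpen_ball : ∀ s ∈ Ioc (0 : ℝ) 1, IsOpen ({x} ∪ ⋃ h, arm h '' Ioo 0 s)

namespace LocalStar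

variable {Γ : Type*} [TopologicalSpace Γ] {x : Γ} {ι : Type*} (S : LocalStar x ι)

/-- The open arm of a star. -/
def openArm (h : ι) : Set Γ := S.arm h '' Ioo 0 1

/-- The open star. -/
def ball : Set Γ := {x} ∪ ⋃ h, S.openArm h

theorem isOpen_openArm (h : ι) : IsOpen (S.openArm h) := S.isOpen_image h _ isOpen_Ioo le_rfl

theorem ball_mem_nhds : S.ball ∈ 𝓝 x :=
  (S.isOpen_ball 1 ⟨one_pos, le_rfl⟩).mem_nhds (Or.inl rfl)

theorem center_notMem_openArm (h : ι) : x ∉ S.openArm h := by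
  rintro ⟨s, hs, he⟩
  exact S.arm_ne h s hs he

theorem disjoint_openArm {h h' : ι} (hh : h ≠ h') : Disjoint (S.openArm h) (S.openArm h') := by
  rw [disjoint_left]
  rintro _ ⟨s, hs, rfl⟩ ⟨s', hs', he⟩
  exact hh (S.arm_inj _ _ _ _ hs hs' he.symm).1

theorem exists_openArm {y : Γ} (hy : y ∈ S.ball) (hne : y ≠ x) : ∃ h, y ∈ S.openArm h := by
  rcases hy with hy | hy
  · exact absurd hy hne
  · exact mem_iUnion.1 hy

theorem exists_arm_mem (h : ι) {U : Set Γ} (hU : U ∈ 𝓝 x) :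
    ∃ s₀ ∈ Ioc (0 : ℝ) 1, ∀ s ∈ Ioo 0 s₀, S.arm h s ∈ U := by
  have hc := S.continuousOn h 0 ⟨le_rfl, one_pos⟩
  rw [ContinuousWithinAt, S.arm_zero] at hc
  have := hc hU
  obtain ⟨ε, hε, hsub⟩ := Metric.mem_nhdsWithin_iff.1 this
  refine ⟨min ε 1, ⟨lt_min hε one_pos, min_le_right _ _⟩, fun s hs => hsub ⟨?_, ?_⟩⟩
  · rw [Metric.mem_ball, Real.dist_eq, sub_zero, abs_of_pos hs.1]
    exact hs.2.trans_le (min_le_left _ _)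
  · exact ⟨hs.1.le, hs.2.trans_le (min_le_right _ _)⟩

/-- A preconnected subset of the punctured star lies in one of the arms. -/
theorem exists_subset_openArm {G : Set Γ} (hG : IsPreconnected G) (hne : G.Nonempty)
    (hsub : G ⊆ S.ball) (hx : x ∉ G) : ∃ h, G ⊆ S.openArm h := by
  obtain ⟨y, hy⟩ := hne
  have mem : ∀ z ∈ G, ∃ h, z ∈ S.openArm h := fun z hz =>
    S.exists_openArm (hsub hz) fun he => hx (he ▸ hz)
  obtain ⟨h, hh⟩ := mem y hy
  refine ⟨h, hG.subset_left_of_subset_union (S.isOpen_openArm h)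
    (isOpen_iUnion fun h' : {h' // h' ≠ h} => S.isOpen_openArm h') ?_ ?_ ⟨y, hy, hh⟩⟩
  · exact disjoint_iUnion_right.2 fun h' => S.disjoint_openArm h'.2.symm
  · intro z hz
    obtain ⟨h', hz'⟩ := mem z hz
    by_cases he : h' = h
    · exact Or.inl (he ▸ hz')
    · exact Or.inr (mem_iUnion.2 ⟨⟨h', he⟩, hz'⟩)

/-- Otherwise the missing point would separate `U` into the part of the arm beyond it and the rest,
which contains the center. -/
theorem arm_mem_of_isPreconnected {U : Set Γ} (hU : IsPreconnected U) (hsub : U ⊆ S.ball)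
    (hx : x ∈ U) {h : ι} {s s' : ℝ} (hs : s ∈ Ioo (0 : ℝ) 1) (hsU : S.arm h s ∈ U)
    (hs' : s' ∈ Ioo 0 s) : S.arm h s' ∈ U := by
  by_contra hc
  have hs'1 : s' < 1 := hs'.2.trans hs.2
  have o1 : IsOpen (S.arm h '' Ioo s' 1) :=
    S.isOpen_image h _ isOpen_Ioo (Ioo_subset_Ioo_left hs'.1.le)
  have o2 : IsOpen (({x} ∪ ⋃ h, S.arm h '' Ioo 0 s') ∪ ⋃ h' : {h' // h' ≠ h}, S.openArm h') :=
    (S.isOpen_ball s' ⟨hs'.1, hs'1.le⟩).union (isOpen_iUnion fun h' => S.isOpen_openArm h')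
  have hd : Disjoint (S.arm h '' Ioo s' 1)
      (({x} ∪ ⋃ h, S.arm h '' Ioo 0 s') ∪ ⋃ h' : {h' // h' ≠ h}, S.openArm h') := by
    rw [disjoint_left]
    rintro _ ⟨r, hr, rfl⟩ ((h1 | h1) | h1)
    · exact S.arm_ne h r ⟨hs'.1.trans hr.1, hr.2⟩ h1
    · obtain ⟨h', r', hr', he⟩ := mem_iUnion.1 h1
      have := (S.arm_inj _ _ _ _ ⟨hr'.1, hr'.2.trans hs'1⟩ ⟨hs'.1.trans hr.1, hr.2⟩ he).2
      exact (hr'.2.trans hr.1).ne this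
    · obtain ⟨h', r', hr', he⟩ := mem_iUnion.1 h1
      exact h'.2 (S.arm_inj _ _ _ _ hr' ⟨hs'.1.trans hr.1, hr.2⟩ he).1
  have hcov : U ⊆ S.arm h '' Ioo s' 1 ∪
      (({x} ∪ ⋃ h, S.arm h '' Ioo 0 s') ∪ ⋃ h' : {h' // h' ≠ h}, S.openArm h') := by
    intro z hz
    by_cases hzx : z = x
    · exact Or.inr (Or.inl (Or.inl hzx))
    obtain ⟨h', r, hr, rfl⟩ := S.exists_openArm (hsub hz) hzx
    by_cases he : h' = h
    · subst he
      rcases lt_trichotomy r s' with hlt | rfl | hlt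
      · exact Or.inr (Or.inl (Or.inr (mem_iUnion.2 ⟨h', r, ⟨hr.1, hlt⟩, rfl⟩)))
      · exact absurd hz hc
      · exact Or.inl ⟨r, ⟨hlt, hr.2⟩, rfl⟩
    · exact Or.inr (Or.inr (mem_iUnion.2 ⟨⟨h', he⟩, r, hr, rfl⟩))
  have := hU.subset_left_of_subset_union o1 o2 hd hcov ⟨_, hsU, s, ⟨hs'.2, hs.2⟩, rfl⟩ hx
  exact disjoint_left.1 hd this (Or.inl (Or.inl rfl))

theorem isPreconnected_inter_openArm {U : Set Γ} (hU : IsPreconnected U) (hsub : U ⊆ S.ball)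
    (hx : x ∈ U) (h : ι) : IsPreconnected (U ∩ S.openArm h) := by
  have : U ∩ S.openArm h = S.arm h '' {s | s ∈ Ioo 0 1 ∧ S.arm h s ∈ U} := by
    ext z
    constructor
    · rintro ⟨hz, s, hs, rfl⟩
      exact ⟨s, ⟨hs, hz⟩, rfl⟩
    · rintro ⟨s, ⟨hs, hz⟩, rfl⟩
      exact ⟨hz, s, hs, rfl⟩
  rw [this]
  refine IsPreconnected.image ?_ _ ((S.continuousOn h).mono fun s hs => ⟨hs.1.1.le, hs.1.2⟩)
  refine OrdConnected.isPreconnected ⟨fun s hs t ht r hr => ?_⟩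
  rcases hr.2.lt_or_eq with hlt | rfl
  · have hr0 : 0 < r := hs.1.1.trans_le hr.1
    exact ⟨⟨hr0, hlt.trans ht.1.2⟩, S.arm_mem_of_isPreconnected hU hsub hx ht.1 ht.2 ⟨hr0, hlt⟩⟩
  · exact ht

/-- The degree of the center of a star is the number of its arms. -/
theorem hasDegree [Finite ι] (S : LocalStar x ι) : HasDegree x (Nat.card ι) := by
  have hev : ∀ᶠ U in (𝓝 x).smallSets, U ⊆ S.ball :=
    eventually_smallSets_subset.2 S.ball_mem_nhds
  filter_upwards [hev] with U hsub hU hconn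
  have hx : x ∈ U := mem_of_mem_nhds hU
  have hmem : ∀ y : ↥(U \ {x}), ∃ h, (y : Γ) ∈ S.openArm h := fun y =>
    S.exists_openArm (hsub y.2.1) y.2.2
  -- The arm containing a point is a locally constant function on the punctured neighborhood. Its
  -- fibers are connected and nonempty, so they are the components.
  choose f hf using hmem
  have hf_eq : ∀ (y : ↥(U \ {x})) h, (y : Γ) ∈ S.openArm h → f y = h := fun y h hy => by
    by_contra hne
    exact disjoint_left.1 (S.disjoint_openArm hne) (hf y) hy
  let _ : TopologicalSpace ι := ⊥
  have : DiscreteTopology ι := ⟨rfl⟩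
  have hcont : Continuous f := by
    rw [continuous_discrete_rng]
    intro h
    have : f ⁻¹' {h} = Subtype.val ⁻¹' S.openArm h := by
      ext y
      exact ⟨fun hy => hy ▸ hf y, fun hy => hf_eq y h hy⟩
    rw [this]
    exact (S.isOpen_openArm h).preimage continuous_subtype_val
  refine Nat.card_eq_of_bijective hcont.connectedComponentsLift ⟨?_, fun h => ?_⟩
  · intro a b hab
    obtain ⟨y, rfl⟩ := ConnectedComponents.surjective_coe a
    obtain ⟨z, rfl⟩ := ConnectedComponents.surjective_coe b
    rw [hcont.connectedComponentsLift_apply_coe, hcont.connectedComponentsLift_apply_coe] at hab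
    rw [ConnectedComponents.coe_eq_coe']
    have hpre : IsPreconnected (f ⁻¹' {f z}) := by
      rw [← IsInducing.subtypeVal.isPreconnected_image]
      have : Subtype.val '' (f ⁻¹' {f z}) = U ∩ S.openArm (f z) := by
        ext w
        constructor
        · rintro ⟨w, hw, rfl⟩
          exact ⟨w.2.1, hw ▸ hf w⟩
        · rintro ⟨hw, hw'⟩
          have hwx : w ≠ x := fun he => S.center_notMem_openArm _ (he ▸ hw')
          exact ⟨⟨w, hw, hwx⟩, hf_eq _ _ hw', rfl⟩
      rw [this]
      exact S.isPreconnected_inter_openArm hconn.isPreconnected hsub hx _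
    exact hpre.subset_connectedComponent rfl hab
  · obtain ⟨s₀, hs₀, hs⟩ := S.exists_arm_mem h hU
    have hs2 : s₀ / 2 ∈ Ioo 0 s₀ := ⟨half_pos hs₀.1, half_lt_self hs₀.1⟩
    have hs1 : s₀ / 2 ∈ Ioo (0 : ℝ) 1 := ⟨hs2.1, hs2.2.trans_le hs₀.2⟩
    refine ⟨((⟨S.arm h (s₀ / 2), hs _ hs2, S.arm_ne h _ hs1⟩ : ↥(U \ {x})) :
      ConnectedComponents ↥(U \ {x})), ?_⟩
    rw [hcont.connectedComponentsLift_apply_coe]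
    exact hf_eq _ _ ⟨_, hs1, rfl⟩

end LocalStar

/-- The point at height `t` on a leg of a star. -/
def Star.leg {n : ℕ} (c : Fin n) (t : ℝ) : Star n :=
  ⟨Pi.single c (max 0 (min 1 t)), fun i => by
    rcases eq_or_ne i c with rfl | h
    · simp
    · simp [h], fun i j hij => by
    rcases eq_or_ne i c with rfl | h
    · exact Or.inr (Pi.single_eq_of_ne hij.symm _)
    · exact Or.inl (Pi.single_eq_of_ne h _)⟩

theorem Star.continuous_leg {n : ℕ} (c : Fin n) : Continuous (Star.leg c) :=
  Continuous.subtype_mk ((continuous_single c).comp (by fun_prop)) _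

theorem Star.leg_apply {n : ℕ} (c : Fin n) {t : ℝ} (ht : t ∈ Icc (0 : ℝ) 1) :
    (Star.leg c t).1 = Pi.single c t := by
  simp [Star.leg, ht.1, ht.2]

theorem Star.eq_leg {n : ℕ} {s : Star n} {c : Fin n} (h : s.1 c ≠ 0) : s = Star.leg c (s.1 c) := by
  refine Subtype.ext ?_
  rw [Star.leg_apply c (s.2.1 c)]
  funext i
  rcases eq_or_ne i c with rfl | hi
  · simp
  · rw [Pi.single_eq_of_ne hi]
    exact (s.2.2 i c hi).resolve_right h

/-- Close to the center, a leg without the center is a connected subset of the punctured star, so it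
stays on one arm. Two legs on one arm both approach the center, and a point of one would disconnect
the other. -/
theorem LocalStar.exists_arms {Γ : Type*} [TopologicalSpace Γ] {x : Γ} {ι : Type*}
    (S : LocalStar x ι) {n : ℕ} (f : Star n → Γ) (hf : Continuous f) (hinj : Function.Injective f)
    (hx : f (Star.center n) = x) :
    ∃ κ : Fin n → ι, Function.Injective κ ∧
      ∀ᶠ s in 𝓝 (Star.center n), ∀ c, s.1 c ≠ 0 → f s ∈ S.openArm (κ c) := by
  have hnear : ∀ N ∈ 𝓝 x, ∃ ε ∈ Ioc (0 : ℝ) 1, ∀ s : Star n, (∀ c, s.1 c < ε) → f s ∈ N := by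
    intro N hN
    have : f ⁻¹' N ∈ 𝓝 (Star.center n) := hf.continuousAt.preimage_mem_nhds (hx ▸ hN)
    obtain ⟨ε, hε, hsub⟩ := Metric.mem_nhds_iff.1 this
    refine ⟨min ε 1, ⟨lt_min hε one_pos, min_le_right _ _⟩, fun s hs => hsub ?_⟩
    rw [Metric.mem_ball, Subtype.dist_eq, dist_pi_lt_iff hε]
    intro c
    change dist (s.1 c) 0 < ε
    rw [Real.dist_eq, sub_zero, abs_of_nonneg (s.2.1 c).1]
    exact (hs c).trans_le (min_le_left _ _)
  have hleg_lt : ∀ (c : Fin n) (t ε : ℝ), t ∈ Ioo 0 ε → ε ≤ 1 → ∀ d, (Star.leg c t).1 d < ε := by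
    intro c t ε ht hε d
    rw [Star.leg_apply c ⟨ht.1.le, ht.2.le.trans hε⟩]
    rcases eq_or_ne d c with rfl | hd
    · simpa using ht.2
    · rw [Pi.single_eq_of_ne hd]
      exact ht.1.trans ht.2
  have hleg_pos : ∀ (c : Fin n) (t : ℝ), t ∈ Ioc (0 : ℝ) 1 → (Star.leg c t).1 c ≠ 0 := by
    intro c t ht
    rw [Star.leg_apply c ⟨ht.1.le, ht.2⟩, Pi.single_eq_same]
    exact ht.1.ne'
  obtain ⟨ε, hε, hball⟩ := hnear _ S.ball_mem_nhds
  have hpre : ∀ c, IsPreconnected ((fun t => f (Star.leg c t)) '' Ioo 0 ε) := fun c =>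
    isPreconnected_Ioo.image _ (hf.comp (Star.continuous_leg c)).continuousOn
  have hκ : ∀ c, ∃ h, (fun t => f (Star.leg c t)) '' Ioo 0 ε ⊆ S.openArm h := by
    intro c
    refine S.exists_subset_openArm (hpre c) ((nonempty_Ioo.2 hε.1).image _) ?_ ?_
    · rintro _ ⟨t, ht, rfl⟩
      exact hball _ (hleg_lt c t ε ht hε.2)
    · rintro ⟨t, ht, he⟩
      have := hinj (he.trans hx.symm)
      exact hleg_pos c t ⟨ht.1, ht.2.le.trans hε.2⟩ (by rw [this]; rfl)
  choose κ hκ using hκ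
  refine ⟨κ, fun c d hcd => ?_, ?_⟩
  · by_contra hne
    -- the images of the two legs are interlaced on a common arm
    have approach : ∀ c', κ c' = κ c → ∀ δ ∈ Ioc (0 : ℝ) 1, ∃ s ∈ Ioo 0 δ,
        S.arm (κ c) s ∈ (fun t => f (Star.leg c' t)) '' Ioo 0 ε := by
      intro c' hc' δ hδ
      obtain ⟨ε', hε', hN⟩ := hnear _ ((S.isOpen_ball δ hδ).mem_nhds (Or.inl rfl))
      have ht : min ε ε' / 2 ∈ Ioo 0 (min ε ε') :=
        ⟨half_pos (lt_min hε.1 hε'.1), half_lt_self (lt_min hε.1 hε'.1)⟩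
      have ht1 : min ε ε' / 2 ∈ Ioo 0 ε := ⟨ht.1, ht.2.trans_le (min_le_left _ _)⟩
      have ht2 : min ε ε' / 2 ∈ Ioo 0 ε' := ⟨ht.1, ht.2.trans_le (min_le_right _ _)⟩
      have hmem := hN _ (hleg_lt c' _ ε' ht2 hε'.2)
      obtain ⟨r, hr, he⟩ := hc' ▸ hκ c' ⟨_, ht1, rfl⟩
      rcases hmem with h1 | h1
      · exact absurd (he.trans h1) (S.arm_ne _ _ hr)
      · obtain ⟨h', r', hr', he'⟩ := mem_iUnion.1 h1
        have := S.arm_inj _ _ _ _ hr ⟨hr'.1, hr'.2.trans_le hδ.2⟩ (he.trans he'.symm)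
        exact ⟨r, this.2 ▸ hr', he ▸ ⟨_, ht1, rfl⟩⟩
    obtain ⟨r₀, hr₀, m₀⟩ := approach c rfl 1 ⟨one_pos, le_rfl⟩
    obtain ⟨r₁, hr₁, t₁, ht₁, m₁⟩ := approach d hcd.symm r₀ ⟨hr₀.1, hr₀.2.le⟩
    have hr₁1 : r₁ < 1 := hr₁.2.trans hr₀.2
    obtain ⟨r₂, hr₂, m₂⟩ := approach c rfl r₁ ⟨hr₁.1, hr₁1.le⟩
    have o1 : IsOpen (S.arm (κ c) '' Ioo 0 r₁) :=
      S.isOpen_image _ _ isOpen_Ioo (Ioo_subset_Ioo_right hr₁1.le)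
    have o2 : IsOpen (S.arm (κ c) '' Ioo r₁ 1) :=
      S.isOpen_image _ _ isOpen_Ioo (Ioo_subset_Ioo_left hr₁.1.le)
    have hd : Disjoint (S.arm (κ c) '' Ioo 0 r₁) (S.arm (κ c) '' Ioo r₁ 1) := by
      rw [disjoint_left]
      rintro _ ⟨a, ha, rfl⟩ ⟨b, hb, he⟩
      have := (S.arm_inj _ _ _ _ ⟨hr₁.1.trans hb.1, hb.2⟩ ⟨ha.1, ha.2.trans hr₁1⟩ he).2
      exact (ha.2.trans hb.1).ne this.symm
    have hcov : (fun t => f (Star.leg c t)) '' Ioo 0 ε ⊆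
        S.arm (κ c) '' Ioo 0 r₁ ∪ S.arm (κ c) '' Ioo r₁ 1 := by
      rintro y ⟨t, ht, rfl⟩
      obtain ⟨r, hr, he⟩ := hκ c ⟨t, ht, rfl⟩
      rcases lt_trichotomy r r₁ with hlt | rfl | hlt
      · exact Or.inl ⟨r, ⟨hr.1, hlt⟩, he⟩
      · have heq := congrArg Subtype.val (hinj (m₁.trans he))
        have h0 := congrFun heq d
        rw [Star.leg_apply c ⟨ht.1.le, ht.2.le.trans hε.2⟩,
          Pi.single_eq_of_ne (Ne.symm hne)] at h0
        exact absurd h0 (hleg_pos d t₁ ⟨ht₁.1, ht₁.2.le.trans hε.2⟩)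
      · exact Or.inr ⟨r, ⟨hlt, hr.2⟩, he⟩
    have hleft := (hpre c).subset_left_of_subset_union o1 o2 hd hcov
      ⟨_, m₂, r₂, hr₂, rfl⟩ m₀
    exact disjoint_left.1 hd hleft ⟨r₀, ⟨hr₁.2, hr₀.2⟩, rfl⟩
  · have hlt : ∀ᶠ s in 𝓝 (Star.center n), ∀ c, s.1 c < ε := eventually_all.2 fun c =>
      ((continuous_apply c).comp continuous_subtype_val).continuousAt.eventually
        (gt_mem_nhds (show (Star.center n).1 c < ε from hε.1))
    filter_upwards [hlt] with s hs c hc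
    rw [Star.eq_leg hc]
    exact hκ c ⟨_, ⟨lt_of_le_of_ne (s.2.1 c).1 hc.symm, hs c⟩, rfl⟩

/-! ## Weights on the edges of a graph -/

section Weights

variable {E V : Type*}

open Classical in
/-- Merging the edges at a finite set of vertices of degree at most two, each class of edges keeps at
most two free ends. -/
theorem exists_edge_classes [Fintype E] (v : E × Bool → V) (J : Finset V)
    (hJ : ∀ w ∈ J, (Finset.univ.filter fun h => v h = w).card ≤ 2) :
    ∃ t : E → E, (∀ h h', v h = v h' → v h ∈ J → t h.1 = t h'.1) ∧
      ∀ a, (Finset.univ.filter fun h => v h ∉ J ∧ t h.1 = a).card ≤ 2 := by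
  induction J using Finset.induction_on with
  | empty =>
    refine ⟨id, fun _ _ _ h => absurd h (Finset.notMem_empty _), fun a => ?_⟩
    refine (Finset.card_le_card (t := {(a, true), (a, false)}) ?_).trans Finset.card_le_two
    rintro ⟨e, b⟩ h
    have : e = a := (Finset.mem_filter.1 h).2.2
    subst this
    cases b <;> simp
  | insert w J hw ih =>
    obtain ⟨t, h1, h2⟩ := ih fun w' h => hJ w' (Finset.mem_insert_of_mem h)
    -- Either the ends at `w` already have the same class, or `w` has exactly two ends, whose
    -- distinct classes are merged.
    by_cases hsame : ∀ h h', v h = w → v h' = w → t h.1 = t h'.1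
    · refine ⟨t, fun h h' e hm => ?_, fun a => (Finset.card_le_card ?_).trans (h2 a)⟩
      · rcases Finset.mem_insert.1 hm with hm | hm
        · exact hsame h h' hm (e ▸ hm)
        · exact h1 h h' e hm
      · intro h hh
        simp only [Finset.mem_filter, Finset.mem_insert, not_or] at hh ⊢
        exact ⟨hh.1, hh.2.1.2, hh.2.2⟩
    · push Not at hsame
      obtain ⟨h, h', hv, hv', hne⟩ := hsame
      have hhne : h ≠ h' := fun e => hne (by rw [e])
      have hcover : ∀ g, v g = w → g = h ∨ g = h' := by
        intro g hg
        have hsub : ({h, h'} : Finset (E × Bool)) ⊆ Finset.univ.filter fun h => v h = w := by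
          intro x hx
          rcases Finset.mem_insert.1 hx with rfl | hx
          · simpa using hv
          · rw [Finset.mem_singleton.1 hx]
            simpa using hv'
        have heq := Finset.eq_of_subset_of_card_le hsub (by
          rw [Finset.card_pair hhne]
          exact hJ w (Finset.mem_insert_self _ _))
        have : g ∈ ({h, h'} : Finset (E × Bool)) := by
          rw [heq]
          simpa using hg
        simpa using this
      refine ⟨fun e => if t e = t h'.1 then t h.1 else t e, fun g g' e hm => ?_, fun a => ?_⟩
      · rcases Finset.mem_insert.1 hm with hm | hm
        · have key : ∀ g, v g = w → (if t g.1 = t h'.1 then t h.1 else t g.1) = t h.1 := by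
            intro g hg
            rcases hcover g hg with rfl | rfl
            · simp
            · simp
          exact (key g hm).trans (key g' (e ▸ hm)).symm
        · simp only [h1 g g' e hm]
      · by_cases ha : a = t h.1
        · subst ha
          have hmem : h ∈ Finset.univ.filter fun g => v g ∉ J ∧ t g.1 = t h.1 := by
            simp [hv, hw]
          have hmem' : h' ∈ Finset.univ.filter fun g => v g ∉ J ∧ t g.1 = t h'.1 := by
            simp [hv', hw]
          -- Each of the two merged classes loses one of its at most two free ends, so at most two
          -- remain in total.
          have c1 := Finset.card_erase_of_mem hmem
          have c2 := Finset.card_erase_of_mem hmem'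
          have := h2 (t h.1)
          have := h2 (t h'.1)
          refine (Finset.card_le_card (t := (Finset.univ.filter
            fun g => v g ∉ J ∧ t g.1 = t h.1).erase h ∪
              (Finset.univ.filter fun g => v g ∉ J ∧ t g.1 = t h'.1).erase h') ?_).trans
            ((Finset.card_union_le _ _).trans (by omega))
          intro g hg
          simp only [Finset.mem_filter, Finset.mem_insert, not_or] at hg
          obtain ⟨-, ⟨hgw, hgJ⟩, hgt⟩ := hg
          have n1 : g ≠ h := fun e => hgw (e ▸ hv)
          have n2 : g ≠ h' := fun e => hgw (e ▸ hv')
          rw [Finset.mem_union]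
          by_cases hc : t g.1 = t h'.1
          · right
            simp [n2, hgJ, hc]
          · left
            rw [if_neg hc] at hgt
            simp [n1, hgJ, hgt]
        · refine (Finset.card_le_card ?_).trans (h2 a)
          intro g hg
          simp only [Finset.mem_filter, Finset.mem_insert, not_or] at hg ⊢
          refine ⟨hg.1, hg.2.1.2, ?_⟩
          by_cases hc : t g.1 = t h'.1
          · rw [if_pos hc] at hg
            exact absurd hg.2.2.symm ha
          · rw [if_neg hc] at hg
            exact hg.2.2

/-- If all the vertices outside `W` have degree at most two, then the edges have weights that agree
at these vertices, but not on any three ends of edges in `W`. -/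
theorem exists_edge_weights [Finite E] (v : E × Bool → V) (W : Set V)
    (hW : ∀ w ∉ W, Nat.card {h // v h = w} ≤ 2) :
    ∃ t : E → ℝ, (∀ h h', v h = v h' → v h ∉ W → t h.1 = t h'.1) ∧
      ∀ κ : Fin 3 → E × Bool, Function.Injective κ → (∀ c, v (κ c) ∈ W) →
        ∃ l, t (κ (l + 1)).1 ≠ t (κ (l + 2)).1 := by
  classical
  have := Fintype.ofFinite E
  obtain ⟨t, h1, h2⟩ := exists_edge_classes v ((Finset.univ.image v).filter (· ∉ W)) (by
    intro w hw
    have := hW w (Finset.mem_filter.1 hw).2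
    rwa [Nat.card_eq_fintype_card, Fintype.card_subtype] at this)
  let f : E → ℝ := fun e => ((Fintype.equivFin E e : ℕ) : ℝ)
  have hf : Function.Injective f := fun a b h =>
    (Fintype.equivFin E).injective (Fin.ext (Nat.cast_injective h))
  refine ⟨f ∘ t, fun h h' e hw => ?_, fun κ hκ hm => ?_⟩
  · exact congrArg f (h1 h h' e (by simp [hw]))
  · by_contra! hall
    -- The cases `0` and `1` already put all three ends into one class, which has at most two free
    -- ends.
    have e0 := hf (hall 0)
    have e1 := hf (hall 1)
    have hsub : Finset.univ.image κ ⊆ Finset.univ.filter fun h =>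
        v h ∉ (Finset.univ.image v).filter (· ∉ W) ∧ t h.1 = t (κ 0).1 := by
      intro g hg
      obtain ⟨c, -, rfl⟩ := Finset.mem_image.1 hg
      refine Finset.mem_filter.2 ⟨Finset.mem_univ _, fun hc => (Finset.mem_filter.1 hc).2 (hm c), ?_⟩
      fin_cases c
      · rfl
      · exact e0.trans e1
      · exact e1
    have := (Finset.card_le_card hsub).trans (h2 _)
    rw [Finset.card_image_of_injective _ hκ] at this
    simp at this

end Weights

/-! ## Parametrized graphs -/

/-- A finite graph given by its vertices and parametrizations of its edges by `[-1, 1]`. -/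
structure GraphParam (Γ : Type*) [TopologicalSpace Γ] (E : Type*) where
  vert : Set Γ
  finite_vert : vert.Finite
  edge : E → ℝ → Γ
  continuousOn : ∀ i, ContinuousOn (edge i) (Icc (-1) 1)
  edge_inj : ∀ i j s s', s ∈ Ioo (-1 : ℝ) 1 → s' ∈ Ioo (-1 : ℝ) 1 → edge i s = edge j s' →
    i = j ∧ s = s'
  edge_notMem : ∀ i s, s ∈ Ioo (-1 : ℝ) 1 → edge i s ∉ vert
  one_mem : ∀ i, edge i 1 ∈ vert
  neg_one_mem : ∀ i, edge i (-1) ∈ vert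
  cover : ∀ x, x ∈ vert ∨ ∃ i, ∃ s ∈ Ioo (-1 : ℝ) 1, edge i s = x

/-- The sign of an end of the interval `[-1, 1]`. -/
def endSign (b : Bool) : ℝ := if b then 1 else -1

theorem endSign_mul_self (b : Bool) : endSign b * endSign b = 1 := by
  cases b <;> norm_num [endSign]

theorem endSign_mul_mem {b : Bool} {s : ℝ} (hs : s ∈ Ioo (-1 : ℝ) 1) :
    endSign b * s ∈ Ioo (-1 : ℝ) 1 := by
  cases b <;> simp only [endSign, mem_Ioo] at hs ⊢ <;> norm_num <;> constructor <;> linarith [hs.1, hs.2]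

theorem add_endSign_mul_mem {s₀ : ℝ} (hs₀ : s₀ ∈ Ioo (-1 : ℝ) 1) (b : Bool) {s : ℝ}
    (hs : s ∈ Ico (0 : ℝ) 1) : s₀ + endSign b * (s * (1 - |s₀|)) ∈ Ioo (-1 : ℝ) 1 := by
  have hδ : 0 < 1 - |s₀| := sub_pos.2 (abs_lt.2 hs₀)
  have h1 := neg_abs_le s₀
  have h2 := le_abs_self s₀
  have h3 : s * (1 - |s₀|) < 1 * (1 - |s₀|) := mul_lt_mul_of_pos_right hs.2 hδ
  have h4 : 0 ≤ s * (1 - |s₀|) := mul_nonneg hs.1 hδ.le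
  cases b <;> simp only [endSign, mem_Ioo] <;> norm_num <;> constructor <;> linarith

namespace GraphParam

variable {Γ : Type*} [TopologicalSpace Γ] {E : Type*} (G : GraphParam Γ E)

theorem endpoint_mem (i : E) {s : ℝ} (hs : s ∈ Icc (-1 : ℝ) 1) (hs' : s ∉ Ioo (-1 : ℝ) 1) :
    G.edge i s ∈ G.vert := by
  have : s = -1 ∨ s = 1 := by
    by_contra! h
    exact hs' ⟨lt_of_le_of_ne hs.1 h.1.symm, lt_of_le_of_ne hs.2 h.2⟩
  rcases this with rfl | rfl
  · exact G.neg_one_mem i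
  · exact G.one_mem i

/-- The vertex at an end of an edge. -/
def endpoint (h : E × Bool) : Γ := G.edge h.1 (endSign h.2)

theorem endpoint_mem_vert (h : E × Bool) : G.endpoint h ∈ G.vert := by
  unfold endpoint endSign
  split_ifs
  · exact G.one_mem _
  · exact G.neg_one_mem _

variable [T2Space Γ] [Finite E]

/-- The complement is the union of finitely many compact images and finitely many points. Openness
in `Γ` is thus checked in the parameter intervals. -/
theorem isOpen_of_isClosed {S : Set Γ}
    (h : ∀ i, IsClosed {s | s ∈ Icc (-1 : ℝ) 1 ∧ G.edge i s ∉ S}) : IsOpen S := by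
  have hS : Sᶜ = (⋃ i, G.edge i '' {s | s ∈ Icc (-1 : ℝ) 1 ∧ G.edge i s ∉ S}) ∪ (G.vert \ S) := by
    ext x
    constructor
    · intro hx
      rcases G.cover x with hv | ⟨i, s, hs, rfl⟩
      · exact Or.inr ⟨hv, hx⟩
      · exact Or.inl (mem_iUnion.2 ⟨i, s, ⟨Ioo_subset_Icc_self hs, hx⟩, rfl⟩)
    · rintro (hx | hx)
      · obtain ⟨i, s, hs, rfl⟩ := mem_iUnion.1 hx
        exact hs.2
      · exact hx.2
  rw [← isClosed_compl_iff, hS]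
  refine IsClosed.union (isClosed_iUnion_of_finite fun i => ?_) (G.finite_vert.sdiff).isClosed
  have hc : IsCompact {s | s ∈ Icc (-1 : ℝ) 1 ∧ G.edge i s ∉ S} :=
    isCompact_Icc.of_isClosed_subset (h i) fun s hs => hs.1
  exact (hc.image_of_continuousOn ((G.continuousOn i).mono fun s hs => hs.1)).isClosed

/-- The star neighborhood of a vertex. -/
def vertexStar (x : Γ) (hx : x ∈ G.vert) : LocalStar x {h : E × Bool // G.endpoint h = x} where
  -- An open arm covers only the half of the edge next to its end, so the two arms of a loop are
  -- disjoint.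
  arm h s := G.edge h.1.1 (endSign h.1.2 * (1 - s))
  arm_zero h := by
    rw [sub_zero, mul_one]
    exact h.2
  arm_inj := by
    rintro ⟨⟨i, b⟩, h⟩ ⟨⟨j, c⟩, h'⟩ s s' hs hs' he
    obtain ⟨rfl, he⟩ := G.edge_inj _ _ _ _
      (endSign_mul_mem ⟨by linarith [hs.2], by linarith [hs.1]⟩)
      (endSign_mul_mem ⟨by linarith [hs'.2], by linarith [hs'.1]⟩) he
    have := hs.2
    have := hs'.2
    cases b <;> cases c <;> simp [endSign] at he ⊢ <;> linarith
  arm_ne h s hs he := by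
    refine G.edge_notMem _ _ (endSign_mul_mem ⟨by linarith [hs.2], by linarith [hs.1]⟩)
      (he ▸ hx)
  continuousOn h := by
    refine (G.continuousOn h.1.1).comp (by fun_prop) fun s hs => ?_
    have h1 := hs.1
    have h2 := hs.2
    cases h.1.2 <;> simp only [endSign, mem_Icc] <;> norm_num <;> constructor <;> linarith
  isOpen_image := by
    rintro ⟨⟨i, b⟩, h⟩ J hJ hsub
    refine G.isOpen_of_isClosed fun j => ?_
    have : {s | s ∈ Icc (-1 : ℝ) 1 ∧ G.edge j s ∉
        (fun s => G.edge i (endSign b * (1 - s))) '' J} =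
        Icc (-1 : ℝ) 1 ∩ {s | j = i → s ∈ (fun s => 1 - endSign b * s) ⁻¹' Jᶜ} := by
      ext s
      refine and_congr_right fun hs => ⟨?_, ?_⟩
      · rintro hn rfl hJs
        refine hn ⟨_, hJs, ?_⟩
        simp only [sub_sub_cancel, ← mul_assoc, endSign_mul_self, one_mul]
      · rintro hn ⟨r, hr, he⟩
        have hr' := endSign_mul_mem (b := b) (s := 1 - r)
          ⟨by linarith [(hsub hr).2], by linarith [(hsub hr).1]⟩
        by_cases hs' : s ∈ Ioo (-1 : ℝ) 1
        · obtain ⟨rfl, rfl⟩ := G.edge_inj _ _ _ _ hr' hs' he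
          refine hn rfl ?_
          simpa only [← mul_assoc, endSign_mul_self, one_mul, sub_sub_cancel] using hr
        · exact G.edge_notMem _ _ hr' (he ▸ G.endpoint_mem j hs hs')
    rw [this]
    refine isClosed_Icc.inter ?_
    by_cases hji : j = i
    · simp only [hji, true_imp_iff]
      exact hJ.isClosed_compl.preimage (by fun_prop)
    · simp [hji]
  isOpen_ball := by
    rintro s₀ hs₀
    refine G.isOpen_of_isClosed fun j => ?_
    have : {s | s ∈ Icc (-1 : ℝ) 1 ∧ G.edge j s ∉ {x} ∪ ⋃ h : {h : E × Bool // G.endpoint h = x},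
        (fun s => G.edge h.1.1 (endSign h.1.2 * (1 - s))) '' Ioo 0 s₀} =
        Icc (-1 : ℝ) 1 ∩ ⋂ b : Bool, {s | G.endpoint (j, b) = x → s₀ ≤ 1 - endSign b * s} := by
      ext s
      refine and_congr_right fun hs => ?_
      rw [mem_iInter, ← not_iff_not, not_not]
      simp only [mem_ofPred_eq, not_forall, not_le]
      constructor
      · rintro (he | hm)
        · have hs' : s ∉ Ioo (-1 : ℝ) 1 := fun h =>
            G.edge_notMem j s h (by rw [mem_singleton_iff.1 he]; exact hx)
          have : s = -1 ∨ s = 1 := by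
            by_contra! h
            exact hs' ⟨lt_of_le_of_ne hs.1 h.1.symm, lt_of_le_of_ne hs.2 h.2⟩
          rcases this with rfl | rfl
          · exact ⟨false, he, by simpa [endSign] using hs₀.1⟩
          · exact ⟨true, he, by simpa [endSign] using hs₀.1⟩
        · obtain ⟨⟨⟨i, b⟩, h⟩, r, hr, he⟩ := mem_iUnion.1 hm
          have hr' := endSign_mul_mem (b := b) (s := 1 - r)
            ⟨by linarith [hr.2, hs₀.2], by linarith [hr.1]⟩
          by_cases hs' : s ∈ Ioo (-1 : ℝ) 1
          · obtain ⟨rfl, rfl⟩ := G.edge_inj _ _ _ _ hr' hs' he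
            refine ⟨b, h, ?_⟩
            simpa only [← mul_assoc, endSign_mul_self, one_mul, sub_sub_cancel] using hr.2
          · exact absurd (he ▸ G.endpoint_mem j hs hs') (G.edge_notMem _ _ hr')
      · rintro ⟨b, h, hlt⟩
        by_cases hs' : s = endSign b
        · left
          rw [hs']
          exact h
        · right
          refine mem_iUnion.2 ⟨⟨(j, b), h⟩, 1 - endSign b * s, ⟨?_, hlt⟩, ?_⟩
          · have h1 := hs.1
            have h2 := hs.2
            rw [sub_pos]
            cases b
            · simp only [endSign] at hs' ⊢
              norm_num at hs' ⊢
              linarith [lt_of_le_of_ne h1 (Ne.symm hs')]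
            · simp only [endSign] at hs' ⊢
              norm_num at hs' ⊢
              exact lt_of_le_of_ne h2 hs'
          · simp only [sub_sub_cancel, ← mul_assoc, endSign_mul_self, one_mul]
    rw [this]
    refine isClosed_Icc.inter (isClosed_iInter fun b => ?_)
    by_cases hb : G.endpoint (j, b) = x
    · simp only [hb, true_imp_iff]
      exact isClosed_le continuous_const (by fun_prop)
    · simp [hb]

/-- The star neighborhood of an interior point of an edge. -/
def edgeStar (i : E) (s₀ : ℝ) (hs₀ : s₀ ∈ Ioo (-1 : ℝ) 1) : LocalStar (G.edge i s₀) Bool :=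
  have hδ : 0 < 1 - |s₀| := sub_pos.2 (abs_lt.2 hs₀)
  have hmem : ∀ (b : Bool) (s : ℝ), s ∈ Ico (0 : ℝ) 1 →
      s₀ + endSign b * (s * (1 - |s₀|)) ∈ Ioo (-1 : ℝ) 1 := fun b s hs =>
    add_endSign_mul_mem hs₀ b hs
  -- Scaling by `1 - |s₀|`, the distance to the nearest end, keeps the arms inside the edge.
  { arm := fun b s => G.edge i (s₀ + endSign b * (s * (1 - |s₀|)))
    arm_zero := fun b => by simp
    arm_inj := by
      intro b c s s' hs hs' he
      have := (G.edge_inj _ _ _ _ (hmem b s ⟨hs.1.le, hs.2⟩) (hmem c s' ⟨hs'.1.le, hs'.2⟩) he).2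
      have h1 := mul_pos hs.1 hδ
      have h2 := mul_pos hs'.1 hδ
      have h3 : b = c ∧ s * (1 - |s₀|) = s' * (1 - |s₀|) := by
        generalize s * (1 - |s₀|) = p at *
        generalize s' * (1 - |s₀|) = q at *
        cases b <;> cases c <;> simp only [endSign] at this <;> norm_num at this ⊢ <;> linarith
      exact ⟨h3.1, mul_right_cancel₀ hδ.ne' h3.2⟩
    arm_ne := by
      intro b s hs he
      have := (G.edge_inj _ _ _ _ (hmem b s ⟨hs.1.le, hs.2⟩) hs₀ he).2
      have h1 := mul_pos hs.1 hδ
      generalize s * (1 - |s₀|) = p at *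
      cases b <;> simp only [endSign] at this <;> norm_num at this <;> linarith
    continuousOn := fun b =>
      (G.continuousOn i).comp (by fun_prop) fun s hs => Ioo_subset_Icc_self (hmem b s hs)
    isOpen_image := by
      intro b J hJ hsub
      refine G.isOpen_of_isClosed fun j => ?_
      have : {s | s ∈ Icc (-1 : ℝ) 1 ∧ G.edge j s ∉
          (fun s => G.edge i (s₀ + endSign b * (s * (1 - |s₀|)))) '' J} =
          Icc (-1 : ℝ) 1 ∩
            {s | j = i → s ∈ (fun s => endSign b * (s - s₀) / (1 - |s₀|)) ⁻¹' Jᶜ} := by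
        ext s
        refine and_congr_right fun hs => ⟨?_, ?_⟩
        · rintro hn rfl hJs
          refine hn ⟨_, hJs, ?_⟩
          simp only [div_mul_cancel₀ _ hδ.ne', ← mul_assoc, endSign_mul_self, one_mul,
            add_sub_cancel]
        · rintro hn ⟨r, hr, he⟩
          have hr' := hmem b r ⟨(hsub hr).1.le, (hsub hr).2⟩
          by_cases hs' : s ∈ Ioo (-1 : ℝ) 1
          · obtain ⟨rfl, rfl⟩ := G.edge_inj _ _ _ _ hr' hs' he
            refine hn rfl ?_
            simpa only [add_sub_cancel_left, ← mul_assoc, endSign_mul_self, one_mul,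
              mul_div_cancel_right₀ _ hδ.ne'] using hr
          · exact G.edge_notMem _ _ hr' (he ▸ G.endpoint_mem j hs hs')
      rw [this]
      refine isClosed_Icc.inter ?_
      by_cases hji : j = i
      · simp only [hji, true_imp_iff]
        exact hJ.isClosed_compl.preimage (by fun_prop)
      · simp [hji]
    isOpen_ball := by
      intro r₀ hr₀
      refine G.isOpen_of_isClosed fun j => ?_
      have : {s | s ∈ Icc (-1 : ℝ) 1 ∧ G.edge j s ∉ {G.edge i s₀} ∪ ⋃ b : Bool,
          (fun s => G.edge i (s₀ + endSign b * (s * (1 - |s₀|)))) '' Ioo 0 r₀} =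
          Icc (-1 : ℝ) 1 ∩ {s | j = i → r₀ * (1 - |s₀|) ≤ |s - s₀|} := by
        ext s
        refine and_congr_right fun hs => ⟨?_, ?_⟩
        · rintro hn rfl
          by_contra! hlt
          refine hn ?_
          rcases lt_trichotomy s s₀ with h | rfl | h
          · right
            rw [abs_of_neg (sub_neg.2 h)] at hlt
            refine mem_iUnion.2 ⟨false, (s₀ - s) / (1 - |s₀|),
              ⟨div_pos (sub_pos.2 h) hδ, (div_lt_iff₀ hδ).2 (by linarith)⟩, ?_⟩
            simp [div_mul_cancel₀ _ hδ.ne', endSign]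
          · exact Or.inl rfl
          · right
            rw [abs_of_pos (sub_pos.2 h)] at hlt
            refine mem_iUnion.2 ⟨true, (s - s₀) / (1 - |s₀|),
              ⟨div_pos (sub_pos.2 h) hδ, (div_lt_iff₀ hδ).2 hlt⟩, ?_⟩
            simp [div_mul_cancel₀ _ hδ.ne', endSign]
        · rintro hn hm
          have key : ∃ b : Bool, ∃ r ∈ Ico 0 r₀,
              G.edge i (s₀ + endSign b * (r * (1 - |s₀|))) = G.edge j s := by
            rcases hm with he | hm
            · exact ⟨true, 0, ⟨le_rfl, hr₀.1⟩, by simpa using he.symm⟩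
            · obtain ⟨b, r, hr, he⟩ := mem_iUnion.1 hm
              exact ⟨b, r, ⟨hr.1.le, hr.2⟩, he⟩
          obtain ⟨b, r, hr, he⟩ := key
          have hr' := hmem b r ⟨hr.1, hr.2.trans_le hr₀.2⟩
          by_cases hs' : s ∈ Ioo (-1 : ℝ) 1
          · obtain ⟨rfl, rfl⟩ := G.edge_inj _ _ _ _ hr' hs' he
            have h1 := hn rfl
            have h2 : r * (1 - |s₀|) < r₀ * (1 - |s₀|) := mul_lt_mul_of_pos_right hr.2 hδ
            have h3 : |endSign b| = 1 := by cases b <;> simp [endSign]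
            rw [add_sub_cancel_left, abs_mul, h3, one_mul,
              abs_of_nonneg (mul_nonneg hr.1 hδ.le)] at h1
            linarith
          · exact G.edge_notMem _ _ hr' (he ▸ G.endpoint_mem j hs hs')
      rw [this]
      refine isClosed_Icc.inter ?_
      by_cases hji : j = i
      · simp only [hji, true_imp_iff]
        exact isClosed_le continuous_const (by fun_prop)
      · simp [hji] }

end GraphParam

/-! ## Cut data on a graph -/

namespace GraphParam

variable {Γ : Type*} [TopologicalSpace Γ] {E : Type*} (G : GraphParam Γ E)

open Classical in
/-- Extension of a function on the edges to the graph. The value at a vertex is that of an edge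
ending there. -/
def extend (w : E → ℝ) (x : Γ) : ℝ :=
  if h : ∃ i, ∃ s ∈ Ioo (-1 : ℝ) 1, G.edge i s = x then w h.choose
  else if h : ∃ h, G.endpoint h = x then w h.choose.1 else 0

theorem extend_edge (w : E → ℝ) (i : E) {s : ℝ} (hs : s ∈ Ioo (-1 : ℝ) 1) :
    G.extend w (G.edge i s) = w i := by
  have h : ∃ j, ∃ s' ∈ Ioo (-1 : ℝ) 1, G.edge j s' = G.edge i s := ⟨i, s, hs, rfl⟩
  rw [extend, dif_pos h]
  obtain ⟨s', hs', he⟩ := h.choose_spec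
  rw [(G.edge_inj _ _ _ _ hs' hs he).1]

theorem extend_endpoint (w : E → ℝ) {x : Γ} (hw : ∀ h h', G.endpoint h = x → G.endpoint h' = x →
    w h.1 = w h'.1) (h : E × Bool) (hx : G.endpoint h = x) : G.extend w x = w h.1 := by
  have h1 : ¬ ∃ i, ∃ s ∈ Ioo (-1 : ℝ) 1, G.edge i s = x := by
    rintro ⟨i, s, hs, rfl⟩
    exact G.edge_notMem i s hs (hx ▸ G.endpoint_mem_vert h)
  have h2 : ∃ h, G.endpoint h = x := ⟨h, hx⟩
  rw [extend, dif_neg h1, dif_pos h2]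
  exact hw _ _ h2.choose_spec hx

variable [T2Space Γ] [Finite E]

theorem extend_openArm (w : E → ℝ) {x : Γ} (hx : x ∈ G.vert)
    (h : {h : E × Bool // G.endpoint h = x}) {y : Γ} (hy : y ∈ (G.vertexStar x hx).openArm h) :
    G.extend w y = w h.1.1 := by
  obtain ⟨s, hs, rfl⟩ := hy
  exact G.extend_edge w _ (endSign_mul_mem ⟨by linarith [hs.2], by linarith [hs.1]⟩)

/-- Near a vertex only weights of edges ending there occur, and near an interior point of an edge
only the weight of this edge. -/
theorem eventually_extend (w : E → ℝ) {x : Γ}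
    (hw : ∀ h h', G.endpoint h = x → G.endpoint h' = x → w h.1 = w h'.1) :
    ∀ᶠ y in 𝓝 x, G.extend w y = G.extend w x := by
  rcases G.cover x with hx | ⟨i, s, hs, rfl⟩
  · filter_upwards [(G.vertexStar x hx).ball_mem_nhds] with y hy
    by_cases hyx : y = x
    · rw [hyx]
    · obtain ⟨h, hh⟩ := (G.vertexStar x hx).exists_openArm hy hyx
      rw [G.extend_openArm w hx h hh, G.extend_endpoint w hw h.1 h.2]
  · filter_upwards [(G.edgeStar i s hs).ball_mem_nhds] with y hy
    by_cases hyx : y = G.edge i s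
    · rw [hyx]
    · obtain ⟨b, r, hr, rfl⟩ := (G.edgeStar i s hs).exists_openArm hy hyx
      rw [G.extend_edge w i hs]
      exact G.extend_edge w i (add_endSign_mul_mem hs b ⟨hr.1.le, hr.2⟩)

/-- The center of an embedded star with three legs is a vertex. -/
theorem mem_vert_of_star (f : Star 3 → Γ) (hf : Continuous f) (hinj : Function.Injective f) :
    f (Star.center 3) ∈ G.vert := by
  rcases G.cover (f (Star.center 3)) with hx | ⟨i, s, hs, he⟩
  · exact hx
  · obtain ⟨κ, hκ, -⟩ := (G.edgeStar i s hs).exists_arms f hf hinj he.symm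
    have := Fintype.card_le_of_injective κ hκ
    simp at this

open Classical in
/-- An embedding of a disjoint union of stars, one for each vertex of degree at least three, is
adapted to some cut data. -/
theorem exists_isAdapted {W : Set Γ}
    (hW : ∀ x, x ∈ W ↔ x ∈ G.vert ∧ ∃ n, 3 ≤ n ∧ HasDegree x n) {r : ℕ} (φ : Stars W r → Γ)
    (hφ : IsEmbedding φ) :
    ∃ (D : CutData Γ (Nat.card W)) (ε : W ≃ Fin (Nat.card W)) (leg : W → Fin 3)
      (τ : W → Fin 3 → ℝ), IsAdapted D φ ε leg τ := by
  let f : W → Star 3 → Γ := fun a s => φ ⟨Sum.inl a, s⟩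
  have hf : ∀ a, Continuous (f a) := fun a =>
    hφ.continuous.comp (continuous_sigmaMk (σ := fun a : W ⊕ Fin r => Star (legs W r a)))
  have hinj : ∀ a a' s s', f a s = f a' s' → a = a' ∧ s = s' := by
    intro a a' s s' h
    obtain ⟨h1, h2⟩ := Sigma.mk.inj (hφ.injective h)
    cases h1
    exact ⟨rfl, eq_of_heq h2⟩
  have hfi : ∀ a, Function.Injective (f a) := fun a s s' h => (hinj a a s s' h).2
  have hv : ∀ a, f a (Star.center 3) ∈ G.vert := fun a => G.mem_vert_of_star _ (hf a) (hfi a)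
  choose κ hκ hκs using fun a => (G.vertexStar _ (hv a)).exists_arms (f a) (hf a) (hfi a) rfl
  -- The three legs leave along distinct arms, so the degree of the center is at least three.
  have hmem : ∀ a, f a (Star.center 3) ∈ W := fun a => (hW _).2 ⟨hv a, _, by
    simpa using Nat.card_le_card_of_injective (κ a) (hκ a), (G.vertexStar _ (hv a)).hasDegree⟩
  have : Finite W := G.finite_vert.subset fun x hx => ((hW x).1 hx).1
  -- The stars are indexed by the finite set `W` and have distinct centers in `W`, so every element
  -- of `W` is a center.
  have hsurj : ∀ x ∈ W, ∃ a, f a (Star.center 3) = x := by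
    intro x hx
    have hi : Function.Injective fun a : W => (⟨f a (Star.center 3), hmem a⟩ : W) :=
      fun a a' h => (hinj a a' _ _ (congrArg Subtype.val h)).1
    obtain ⟨a, ha⟩ := Finite.surjective_of_injective hi ⟨x, hx⟩
    exact ⟨a, congrArg Subtype.val ha⟩
  obtain ⟨w, hw, hwne⟩ := exists_edge_weights G.endpoint W (by
    intro x hx
    by_cases hxv : x ∈ G.vert
    · by_contra! hlt
      exact hx ((hW x).2 ⟨hxv, _, hlt, (G.vertexStar x hxv).hasDegree⟩)
    · have : IsEmpty {h // G.endpoint h = x} := ⟨fun h => hxv (h.2 ▸ G.endpoint_mem_vert h.1)⟩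
      simp)
  choose l hl using fun a => hwne (fun c => (κ a c).1) (Subtype.val_injective.comp (hκ a))
    fun c => (κ a c).2.symm ▸ hmem a
  have hext : ∀ x ∉ W, ∀ᶠ y in 𝓝 x, G.extend w y = G.extend w x := fun x hx =>
    G.eventually_extend w fun h h' e e' => hw h h' (e.trans e'.symm) (e ▸ hx)
  let ε := Finite.equivFin W
  let D : CutData Γ (Nat.card W) :=
    { pt := fun v => f (ε.symm v) (Star.center 3)
      pt_injective := fun v v' h => ε.symm.injective (hinj _ _ _ _ h).1
      t := G.extend w
      eventually_t := fun x hx => hext x fun hxW => by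
        obtain ⟨a, ha⟩ := hsurj x hxW
        exact hx (ε a) (by rw [ε.symm_apply_apply, ha])
      -- The indicator function of the open arm along which the distinguished leg starts.
      χ := fun v y => if y ∈ (G.vertexStar _ (hv (ε.symm v))).openArm
        (κ (ε.symm v) (l (ε.symm v))) then 1 else 0
      χ_pt := fun v => if_neg (LocalStar.center_notMem_openArm _ _)
      eventually_χ := fun v => by
        filter_upwards [(G.vertexStar _ (hv (ε.symm v))).ball_mem_nhds] with y hy hne
        obtain ⟨h, hh⟩ := LocalStar.exists_openArm _ hy hne
        filter_upwards [(LocalStar.isOpen_openArm _ h).mem_nhds hh] with z hz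
        by_cases hc : h = κ (ε.symm v) (l (ε.symm v))
        · rw [if_pos (hc ▸ hz), if_pos (hc ▸ hh)]
        · rw [if_neg (disjoint_left.1 (LocalStar.disjoint_openArm _ hc) hz),
            if_neg (disjoint_left.1 (LocalStar.disjoint_openArm _ hc) hh)] }
  refine ⟨D, ε, l, fun a c => w (κ a c).1.1, ⟨fun a => ?_, fun a s c hs => ?_, fun a => ?_, hl⟩⟩
  · change f a _ = f (ε.symm (ε a)) _
    rw [ε.symm_apply_apply]
  · change G.extend w (f a s) = _
    have hlc : ∀ u ∈ Ioc (0 : ℝ) 1, (Star.leg c u).1 c = u := fun u hu => by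
      rw [Star.leg_apply c ⟨hu.1.le, hu.2⟩, Pi.single_eq_same]
    -- Every essential vertex is the center of a star, so by injectivity none lies on a leg outside
    -- the center. Hence the weight is constant along the leg.
    have hnot : ∀ u ∈ Ioc (0 : ℝ) 1, f a (Star.leg c u) ∉ W := by
      intro u hu hm
      obtain ⟨a', ha'⟩ := hsurj _ hm
      have h1 := hlc u hu
      rw [← (hinj _ _ _ _ ha').2] at h1
      exact hu.1.ne h1
    have hcont : Continuous fun u => f a (Star.leg c u) := (hf a).comp (Star.continuous_leg c)
    have hconst : ∀ u ∈ Ioc (0 : ℝ) 1, ∀ u' ∈ Ioc (0 : ℝ) 1,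
        G.extend w (f a (Star.leg c u)) = G.extend w (f a (Star.leg c u')) := fun u hu u' hu' =>
      eq_of_eventually_eq (f := fun u => G.extend w (f a (Star.leg c u))) isPreconnected_Ioc
        (fun x hx => hcont.continuousAt.eventually (hext _ (hnot x hx))) hu hu'
    have h0 : Star.leg c 0 = Star.center 3 := by
      refine Subtype.ext ?_
      rw [Star.leg_apply c ⟨le_rfl, zero_le_one⟩, Pi.single_zero]
      rfl
    -- The constant is read off close to the center, where the leg runs inside its arm.
    have hnear : ∀ᶠ u in 𝓝[>] (0 : ℝ), ∀ d, (Star.leg c u).1 d ≠ 0 →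
        f a (Star.leg c u) ∈ (G.vertexStar _ (hv a)).openArm (κ a d) :=
      ((Star.continuous_leg c).tendsto' 0 _ h0).mono_left nhdsWithin_le_nhds |>.eventually (hκs a)
    obtain ⟨u, hu, hu1⟩ := (hnear.and (Ioc_mem_nhdsGT (zero_lt_one (α := ℝ)))).exists
    have hsc : s.1 c ∈ Ioc (0 : ℝ) 1 := ⟨lt_of_le_of_ne (s.2.1 c).1 hs.symm, (s.2.1 c).2⟩
    rw [Star.eq_leg hs, hconst _ hsc u hu1]
    exact G.extend_openArm w (hv a) (κ a c) (hu c (by rw [hlc u hu1]; exact hu1.1.ne'))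
  · filter_upwards [hκs a] with s hs
    -- A variable `b` stands for `ε.symm (ε a)`, so that the equality with `a` can be eliminated
    -- inside dependent terms.
    have key : ∀ b, b = a → (if f a s ∈ (G.vertexStar _ (hv b)).openArm (κ b (l b)) then
        (1 : ℝ) else 0) = if s.1 (l a) ≠ 0 then 1 else 0 := by
      rintro b rfl
      refine if_congr ⟨fun hm => ?_, hs _⟩ rfl rfl
      by_contra h0
      by_cases hc : ∃ d, s.1 d ≠ 0
      · obtain ⟨d, hd⟩ := hc
        have hne : κ b d ≠ κ b (l b) := fun h => hd (hκ b h ▸ h0)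
        exact disjoint_left.1 (LocalStar.disjoint_openArm _ hne) (hs d hd) hm
      · push Not at hc
        have : s = Star.center 3 := Subtype.ext (funext hc)
        exact LocalStar.center_notMem_openArm _ _ (this ▸ hm)
    exact key _ (ε.symm_apply_apply a)

end GraphParam

/-! ## One-dimensional finite CW complexes -/

theorem const_mem_ball {s : ℝ} (hs : s ∈ Ioo (-1 : ℝ) 1) :
    (fun _ : Fin 1 => s) ∈ Metric.ball (0 : Fin 1 → ℝ) 1 := by
  rw [mem_ball_zero_iff, pi_norm_lt_iff one_pos]
  exact fun _ => abs_lt.2 hs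

/-- The parametrization of a finite CW complex of dimension at most one by its characteristic
maps. -/
def cwGraphParam (Γ : Type*) [TopologicalSpace Γ] [CWComplex (univ : Set Γ)]
    [RelCWComplex.Finite (univ : Set Γ)]
    (hdim : ∀ n : ℕ, 2 ≤ n → IsEmpty (RelCWComplex.cell (univ : Set Γ) n)) :
    GraphParam Γ (RelCWComplex.cell (univ : Set Γ) 1) where
  vert := {v | ∃ i : RelCWComplex.cell (univ : Set Γ) 0, v ∈ RelCWComplex.closedCell 0 i}
  finite_vert := by
    have : Finite (RelCWComplex.cell (univ : Set Γ) 0) :=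
      RelCWComplex.FiniteType.finite_cell (C := (univ : Set Γ)) 0
    refine (finite_range fun i : RelCWComplex.cell (univ : Set Γ) 0 =>
      RelCWComplex.map 0 i ![]).subset ?_
    rintro v ⟨i, hi⟩
    rw [RelCWComplex.closedCell_zero_eq_singleton] at hi
    exact ⟨i, hi.symm⟩
  edge i s := RelCWComplex.map 1 i fun _ => s
  continuousOn i := (RelCWComplex.continuousOn 1 i).comp (by fun_prop) fun s hs => by
    rw [mem_closedBall_zero_iff, pi_norm_le_iff_of_nonneg zero_le_one]
    exact fun _ => abs_le.2 hs
  edge_inj i j s s' hs hs' he := by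
    have hij : i = j := by
      by_contra hne
      refine disjoint_left.1 (RelCWComplex.disjoint_openCell_of_ne (C := (univ : Set Γ))
        (i := i) (j := j) (n := 1) (m := 1) fun h => hne (by simpa using h))
        (mem_image_of_mem _ (const_mem_ball hs)) ?_
      rw [he]
      exact mem_image_of_mem _ (const_mem_ball hs')
    subst hij
    refine ⟨rfl, congrFun ((RelCWComplex.map 1 i).injOn ?_ ?_ he) 0⟩ <;>
      rw [RelCWComplex.source_eq]
    · exact const_mem_ball hs
    · exact const_mem_ball hs'
  edge_notMem i s hs := by
    rintro ⟨j, hj⟩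
    rw [RelCWComplex.closedCell_zero_eq_singleton,
      ← RelCWComplex.openCell_zero_eq_singleton] at hj
    refine disjoint_left.1 (RelCWComplex.disjoint_openCell_of_ne (C := (univ : Set Γ))
      (i := i) (j := j) (n := 1) (m := 0) fun h => ?_)
      (mem_image_of_mem _ (const_mem_ball hs)) hj
    simpa using congrArg Sigma.fst h
  one_mem i := by
    obtain ⟨x, y, h⟩ := CWComplex.exists_cellFrontier_one_eq i
    have hm : RelCWComplex.map 1 i (fun _ => 1) ∈ RelCWComplex.cellFrontier 1 i := by
      rw [RelCWComplex.cellFrontier_one_eq]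
      exact mem_image_of_mem _ (Or.inr rfl)
    rw [h] at hm
    exact hm.elim (fun h => ⟨x, h⟩) fun h => ⟨y, h⟩
  neg_one_mem i := by
    obtain ⟨x, y, h⟩ := CWComplex.exists_cellFrontier_one_eq i
    have hm : RelCWComplex.map 1 i (fun _ => -1) ∈ RelCWComplex.cellFrontier 1 i := by
      rw [RelCWComplex.cellFrontier_one_eq]
      exact mem_image_of_mem _ (Or.inl rfl)
    rw [h] at hm
    exact hm.elim (fun h => ⟨x, h⟩) fun h => ⟨y, h⟩
  cover x := by
    have hx : x ∈ (univ : Set Γ) := mem_univ x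
    rw [← CWComplex.iUnion_openCell_eq_complex (C := (univ : Set Γ))] at hx
    obtain ⟨n, i, hi⟩ := by simpa only [mem_iUnion] using hx
    match n, i, hi with
    | 0, i, hi => exact Or.inl ⟨i, RelCWComplex.openCell_subset_closedCell 0 i hi⟩
    | 1, i, ⟨p, hp, he⟩ =>
      rw [mem_ball_zero_iff, pi_norm_lt_iff one_pos] at hp
      refine Or.inr ⟨i, p 0, abs_lt.1 (hp 0), ?_⟩
      rw [← he]
      exact congrArg _ (funext fun c => congrArg p (Subsingleton.elim 0 c))
    | n + 2, i, _ => exact ((hdim (n + 2) (by omega)).false i).elim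

end GraphConf

end

theorem proposition3p6 {Γ : Type*} [TopologicalSpace Γ] [T2Space Γ]
    [Topology.CWComplex (Set.univ : Set Γ)] [Topology.RelCWComplex.Finite (Set.univ : Set Γ)]
    (hdim : ∀ n : ℕ, 2 ≤ n → IsEmpty (Topology.RelCWComplex.cell (Set.univ : Set Γ) n)) (k : ℕ) :
    (∀ α : GraphConf.H (GraphConf.essentialCount Γ) (GraphConf.UConf (Fin k) Γ),
      GraphConf.IsMaximalTorus α → ¬ IsOfFinAddOrder α) ∧
    (∀ α : GraphConf.H (GraphConf.essentialCount Γ) (GraphConf.Conf (Fin k) Γ),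
      GraphConf.IsMaximalOrderedTorus α → ¬ IsOfFinAddOrder α) := by
  have : Finite (Topology.RelCWComplex.cell (Set.univ : Set Γ) 1) :=
    Topology.RelCWComplex.FiniteType.finite_cell (C := (Set.univ : Set Γ)) 1
  constructor
  · rintro α ⟨r, φ, hφ, e, x, hx, rfl⟩
    obtain ⟨D, ε, leg, τ, hD⟩ :=
      (GraphConf.cwGraphParam Γ hdim).exists_isAdapted (fun _ => Iff.rfl) φ hφ
    exact (hD.not_isOfFinAddOrder hφ e hx).1
  · rintro α ⟨r, φ, hφ, e, x, hx, rfl⟩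
    obtain ⟨D, ε, leg, τ, hD⟩ :=
      (GraphConf.cwGraphParam Γ hdim).exists_isAdapted (fun _ => Iff.rfl) φ hφ
    exact (hD.not_isOfFinAddOrder hφ e hx).2
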